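/- **Setting.** Let $1\le k<n$ and $q\ge 1$ be integers, let $X\in\mathbb{R}^{n\times k}$ have rank $k$, let $R\in\mathbb{R}^{q\times k}$ have rank $q$, and let $r\in\mathbb{R}^q$. Put $\mathfrak{M}_0=\{X\beta:\beta\in\mathbb{R}^k,\ R\beta=r\}$ and let $\mathfrak{M}_0^{lin}=\{X\beta: R\beta=0\}$ be the linear space parallel to $\mathfrak{M}_0$. Let $\mathfrak{F}_{\mathrm{all}}$ be the set of all normalized spectral densities, i.e. of all even integrable $f:[-\pi,\pi]\to[0,\infty)$ with $\int_{-\pi}^{\pi}f(\omega)\,d\omega=1$; put $\Sigma(f)=\big[\int_{-\pi}^{\pi}e^{-\iota(j-l)\omega}f(\omega)\,d\omega\big]_{j,l=1}^n$ and $\mathfrak{C}=\{\Sigma(f):f\in\mathfrak{F}_{\mathrm{all}}\}$. Let $P_{\mu,A}$ denote the Gaussian law on $\mathbb{R}^n$ with mean $\mu$ and covariance matrix $A$. **Test statistic.** Let $\mathsf{W}$ be a symmetric nonnegative definite $n\times n$ Toeplitz matrix with ones on the main diagonal. For $y\in\mathbb{R}^n$ let $\hat\beta(y)=(X'X)^{-1}X'y$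 and $\hat u(y)=y-X\hat\beta(y)$; let $\hat K(y)$ be the $n\times n$ matrix with entries $\hat K_{ij}(y)=n^{-1}\sum_{l=|i-j|+1}^{n}\hat u_l(y)\hat u_{l-|i-j|}(y)$; let $\hat\Psi(y)=n^{-1}X'(\hat K(y)\bullet\mathsf{W})X$, where $\bullet$ is the Hadamard product; and let $\hat\Omega(y)=nR(X'X)^{-1}\hat\Psi(y)(X'X)^{-1}R'$. The weighted Eicker statistic is $T_{E,\mathsf{W}}(y)=(R\hat\beta(y)-r)'\hat\Omega(y)^{-1}(R\hat\beta(y)-r)$ if $\det\hat\Omega(y)\ne0$, and $T_{E,\mathsf{W}}(y)=0$ otherwise. For $C\in\mathbb{R}$ let $$\mathrm{size}(C)=\sup_{\mu_0\in\mathfrak{M}_0}\ \sup_{0<\sigma^2<\infty}\ \sup_{f\in\mathfrak{F}_{\mathrm{all}}}P_{\mu_0,\sigma^2\Sigma(f)}\big(T_{E,\mathsf{W}}\ge C\big).$$ **The index $\rho$.** For $\omega\in[0,\pi]$ and an integer $s\ge0$ let $E_{n,s}(\omega)$ be the $n\times2$ matrix with $j$-th row $(j^s\cos(j\omega),\,j^s\sin(j\omega))$,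 $j=1,\dots,n$. For a linear subspace $\mathcal{L}\subseteq\mathbb{R}^n$ with $\dim\mathcal{L}<n$ let $\rho(\omega,\mathcal{L})=\min\{s\ge0:\mathrm{span}(E_{n,s}(\omega))\not\subseteq\mathcal{L}\}$. **The bound $\alpha^*$.** Put $\mathcal{L}=\mathfrak{M}_0^{lin}$, let $\Pi$ be the orthogonal projection onto $\mathcal{L}^\perp$ and, for a matrix norm $\|\cdot\|$ (say the Frobenius norm), let $\mathcal{L}(\mathfrak{C})=\{\Pi\Sigma\Pi/\|\Pi\Sigma\Pi\|:\Sigma\in\mathfrak{C}\}$. Let $\mathbb{J}$ be the set of the column spaces $\mathrm{span}(\bar\Sigma)$ of all matrices $\bar\Sigma$ in the closure of $\mathcal{L}(\mathfrak{C})$ with $\mathrm{rank}(\bar\Sigma)<n-\dim\mathcal{L}$. Let $\mathbb{H}$ be the set of those $\mathcal{S}\in\mathbb{J}$ for which, for some $\mu_0\in\mathfrak{M}_0$, $T_{E,\mathsf{W}}$ is equal to a constant $C(\mathcal{S})$ almost everywhere on $\mu_0+\mathcal{S}$ with respect to Lebesgue measure on $\mu_0+\mathcal{S}$. Put $C^*=\sup_{\mathcal{S}\in\mathbb{H}}C(\mathcal{S})$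 (with $C^*=-\infty$ if $\mathbb{H}=\emptyset$) and $$\alpha^*=\sup_{C\in(C^*,\infty)}\mathrm{size}(C).$$ **Theorem.** Suppose that $$\mathrm{span}\big(E_{n,\rho(\gamma,\mathfrak{M}_0^{lin})}(\gamma)\big)\not\subseteq\mathrm{span}(X)\quad\text{for every }\gamma\in[0,\pi].\tag{1}$$ Then for every $\alpha\in(0,1)$ there is a real number $C(\alpha)$ with $\mathrm{size}(C(\alpha))\le\alpha$. Moreover, under the same condition, for every $\alpha\in(0,\alpha^*]\cap(0,1)$ there is a real number $C(\alpha)$ with $\mathrm{size}(C(\alpha))=\alpha$. Condition (1) is equivalent to $$\mathrm{rank}\big(X,E_{n,\rho(\gamma,\mathfrak{M}_0^{lin})}(\gamma)\big)>k\quad\text{for every }\gamma\in[0,\pi].$$ -/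

import Mathlib

open MeasureTheory ProbabilityTheory Set
open scoped Matrix ENNReal

noncomputable section

namespace Eicker

/-- The sample space `ℝⁿ` with its Euclidean structure. -/
abbrev Rn (n : ℕ) : Type := EuclideanSpace ℝ (Fin n)

/-- The subspace of `ℝⁿ` spanned by the columns of a matrix with `n` rows. -/
def colSpan {n : ℕ} {ι : Type} (A : Matrix (Fin n) ι ℝ) : Submodule ℝ (Rn n) :=
  Submodule.span ℝ (Set.range fun j : ι => (WithLp.toLp 2 (fun i => A i j) : Rn n))

/-! ### The linear model and the null hypothesis -/

/-- The affine space `{X β : R β = r}` of means allowed under the null hypothesis. -/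
def nullMeans {n k q : ℕ} (X : Matrix (Fin n) (Fin k) ℝ) (R : Matrix (Fin q) (Fin k) ℝ)
    (r : Fin q → ℝ) : Set (Rn n) :=
  {μ | ∃ β : Fin k → ℝ, μ = WithLp.toLp 2 (X *ᵥ β) ∧ R *ᵥ β = r}

/-- The linear space `{X β : R β = 0}` parallel to `nullMeans X R r`; see
`nullMeans_eq_translate`. -/
def nullDir {n k q : ℕ} (X : Matrix (Fin n) (Fin k) ℝ) (R : Matrix (Fin q) (Fin k) ℝ) :
    Submodule ℝ (Rn n) where
  carrier := nullMeans X R 0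
  zero_mem' := ⟨0, by simp, by simp⟩
  add_mem' := by
    rintro _ _ ⟨b, rfl, hb⟩ ⟨c, rfl, hc⟩
    exact ⟨b + c, by rw [Matrix.mulVec_add, WithLp.toLp_add], by rw [Matrix.mulVec_add, hb, hc, add_zero]⟩
  smul_mem' := by
    rintro a _ ⟨b, rfl, hb⟩
    exact ⟨a • b, by rw [Matrix.mulVec_smul, WithLp.toLp_smul], by rw [Matrix.mulVec_smul, hb, smul_zero]⟩

theorem nullMeans_eq_translate {n k q : ℕ} (X : Matrix (Fin n) (Fin k) ℝ)
    (R : Matrix (Fin q) (Fin k) ℝ) (r : Fin q → ℝ) {μ₀ : Rn n} (h : μ₀ ∈ nullMeans X R r) :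
    nullMeans X R r = (fun s => μ₀ + s) '' (nullDir X R : Set (Rn n)) := by
  obtain ⟨b₀, rfl, hb₀⟩ := h
  ext y
  constructor
  · rintro ⟨b, rfl, hb⟩
    refine ⟨WithLp.toLp 2 (X *ᵥ (b - b₀)), ⟨b - b₀, rfl, ?_⟩, ?_⟩
    · rw [Matrix.mulVec_sub, hb, hb₀, sub_self]
    · simp only []
      rw [← WithLp.toLp_add, ← Matrix.mulVec_add, add_sub_cancel]
  · rintro ⟨_, ⟨c, rfl, hc⟩, rfl⟩
    refine ⟨b₀ + c, ?_, ?_⟩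
    · rw [Matrix.mulVec_add, WithLp.toLp_add]
    · rw [Matrix.mulVec_add, hb₀, hc, add_zero]

/-! ### The stationary covariance model -/

/-- Normalized spectral densities: integrable, nonnegative, even functions on `[-π, π]` with
integral one (values outside `[-π, π]` are irrelevant). -/
def normalizedSpectralDensities : Set (ℝ → ℝ) :=
  {f | (∀ ω ∈ Icc (-Real.pi) Real.pi, 0 ≤ f ω) ∧
    (∀ ω ∈ Icc (-Real.pi) Real.pi, f (-ω) = f ω) ∧
    IntervalIntegrable f volume (-Real.pi) Real.pi ∧
    ∫ ω in (-Real.pi)..Real.pi, f ω = 1}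

/-- The `n × n` matrix with entries `∫_{-π}^{π} exp(-i (j - l) ω) f(ω) dω`. For a spectral density
`f` these integrals are real because `f` is even, so taking the real part changes nothing. -/
def spectralCov (n : ℕ) (f : ℝ → ℝ) : Matrix (Fin n) (Fin n) ℝ :=
  Matrix.of fun j l =>
    (∫ ω in (-Real.pi)..Real.pi,
      Complex.exp (-(Complex.I * (((j : ℕ) : ℂ) - ((l : ℕ) : ℂ)) * (ω : ℂ))) * (f ω : ℂ)).re

/-- The covariance model `{Σ(f) : f ∈ F}` induced by a set `F` of spectral densities. -/
def covModel (n : ℕ) (F : Set (ℝ → ℝ)) : Set (Matrix (Fin n) (Fin n) ℝ) :=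
  spectralCov n '' F

/-! ### The weighted Eicker statistic -/

/-- The least squares estimator `(X'X)⁻¹ X' y`. -/
def olsBeta {n k : ℕ} (X : Matrix (Fin n) (Fin k) ℝ) (y : Rn n) : Fin k → ℝ :=
  ((Xᵀ * X)⁻¹ * Xᵀ) *ᵥ (fun i => y i)

/-- The least squares residuals `y - X β̂(y)`. -/
def olsResid {n k : ℕ} (X : Matrix (Fin n) (Fin k) ℝ) (y : Rn n) : Fin n → ℝ :=
  (fun i => y i) - X *ᵥ olsBeta X y

/-- The Toeplitz matrix of empirical autocovariances of the residuals: its `(i, j)` entry is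
`n⁻¹ ∑ û_l û_m` over all pairs of indices `l, m` with `l - m = |i - j|`. -/
def residAutocov {n k : ℕ} (X : Matrix (Fin n) (Fin k) ℝ) (y : Rn n) : Matrix (Fin n) (Fin n) ℝ :=
  Matrix.of fun i j => (n : ℝ)⁻¹ *
    ∑ l : Fin n, ∑ m : Fin n,
      if (l : ℕ) = (m : ℕ) + (((i : ℕ) : ℤ) - ((j : ℕ) : ℤ)).natAbs
      then olsResid X y l * olsResid X y m else 0

/-- `Ψ̂(y) = n⁻¹ X' (K̂(y) ⊙ W) X`, with `⊙` the entrywise product. -/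
def psiHat {n k : ℕ} (X : Matrix (Fin n) (Fin k) ℝ) (W : Matrix (Fin n) (Fin n) ℝ) (y : Rn n) :
    Matrix (Fin k) (Fin k) ℝ :=
  (n : ℝ)⁻¹ • (Xᵀ * (Matrix.hadamard (residAutocov X y) W) * X)

/-- `Ω̂(y) = n R (X'X)⁻¹ Ψ̂(y) (X'X)⁻¹ R'`. -/
def omegaHat {n k q : ℕ} (X : Matrix (Fin n) (Fin k) ℝ) (R : Matrix (Fin q) (Fin k) ℝ)
    (W : Matrix (Fin n) (Fin n) ℝ) (y : Rn n) : Matrix (Fin q) (Fin q) ℝ :=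
  (n : ℝ) • (R * (Xᵀ * X)⁻¹ * psiHat X W y * (Xᵀ * X)⁻¹ * Rᵀ)

open Classical in
/-- The weighted Eicker test statistic: `(R β̂ - r)' Ω̂⁻¹ (R β̂ - r)` if `det Ω̂ ≠ 0`, and zero
otherwise. -/
def eickerStat {n k q : ℕ} (X : Matrix (Fin n) (Fin k) ℝ) (R : Matrix (Fin q) (Fin k) ℝ)
    (r : Fin q → ℝ) (W : Matrix (Fin n) (Fin n) ℝ) (y : Rn n) : ℝ :=
  if (omegaHat X R W y).det ≠ 0 then
    (R *ᵥ olsBeta X y - r) ⬝ᵥ ((omegaHat X R W y)⁻¹ *ᵥ (R *ᵥ olsBeta X y - r))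
  else 0

/-- Symmetric nonnegative definite Toeplitz matrices with ones on the main diagonal. -/
def IsWeightMatrix {n : ℕ} (W : Matrix (Fin n) (Fin n) ℝ) : Prop :=
  W.PosSemidef ∧ (∃ w : ℤ → ℝ, ∀ i j : Fin n, W i j = w (((i : ℕ) : ℤ) - ((j : ℕ) : ℤ))) ∧
    ∀ i, W i i = 1

/-! ### The matrices `E_{n,s}(ω)` and the index `ρ` -/

/-- The `n × 2` matrix whose `j`-th row, `j = 1, …, n`, is `(j^s cos(jω), j^s sin(jω))`. -/
def trigMatrix (n s : ℕ) (ω : ℝ) : Matrix (Fin n) (Fin 2) ℝ :=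
  Matrix.of fun j => ![(((j : ℕ) : ℝ) + 1) ^ s * Real.cos ((((j : ℕ) : ℝ) + 1) * ω),
    (((j : ℕ) : ℝ) + 1) ^ s * Real.sin ((((j : ℕ) : ℝ) + 1) * ω)]

/-- The smallest `s` such that the columns of `E_{n,s}(ω)` do not all lie in `L`; such an `s`
exists when `dim L < n`. -/
def rho {n : ℕ} (ω : ℝ) (L : Submodule ℝ (Rn n)) : ℕ :=
  sInf {s : ℕ | ¬ colSpan (trigMatrix n s ω) ≤ L}

/-! ### Size, and the bound `α*` -/

/-- The size of the test rejecting when `T ≥ C`: the supremum of its rejection probabilities over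
all Gaussian laws with mean in `M₀` and covariance `σ² Σ`, `0 < σ² < ∞`, `Σ ∈ 𝒞`. -/
def size {n : ℕ} (M₀ : Set (Rn n)) (𝒞 : Set (Matrix (Fin n) (Fin n) ℝ)) (T : Rn n → ℝ) (C : ℝ) :
    ℝ≥0∞ :=
  ⨆ μ₀ ∈ M₀, ⨆ σ2 ∈ Ioi (0 : ℝ), ⨆ S ∈ 𝒞, multivariateGaussian μ₀ (σ2 • S) {y | C ≤ T y}

/-- The matrix of the orthogonal projection onto the orthogonal complement of `L`. -/
def projPerp {n : ℕ} (L : Submodule ℝ (Rn n)) : Matrix (Fin n) (Fin n) ℝ :=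
  (Matrix.toEuclideanCLM (n := Fin n) (𝕜 := ℝ)).symm Lᗮ.starProjection

/-- The Frobenius norm. -/
def frob {n : ℕ} (A : Matrix (Fin n) (Fin n) ℝ) : ℝ := Real.sqrt (∑ i, ∑ j, A i j ^ 2)

/-- `Π Σ Π / ‖Π Σ Π‖`, with `Π` the orthogonal projection onto the orthogonal complement of `L`. -/
def normalizedProj {n : ℕ} (L : Submodule ℝ (Rn n)) (S : Matrix (Fin n) (Fin n) ℝ) :
    Matrix (Fin n) (Fin n) ℝ :=
  (frob (projPerp L * S * projPerp L))⁻¹ • (projPerp L * S * projPerp L)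

/-- The column spaces of those limit points of `normalizedProj L '' 𝒞` that have rank smaller than
`n - dim L`. -/
def limitSpaces {n : ℕ} (L : Submodule ℝ (Rn n)) (𝒞 : Set (Matrix (Fin n) (Fin n) ℝ)) :
    Set (Submodule ℝ (Rn n)) :=
  {V | ∃ S ∈ closure (normalizedProj L '' 𝒞), S.rank < n - Module.finrank ℝ L ∧ V = colSpan S}

/-- Lebesgue measure on the affine subspace `μ + V`, as a measure on `ℝⁿ` (it is the point mass at
`μ` if `V = 0`). -/
def affineLebesgue {n : ℕ} (μ : Rn n) (V : Submodule ℝ (Rn n)) : Measure (Rn n) :=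
  ((stdOrthonormalBasis ℝ V).toBasis.addHaar).map (fun v : V => μ + (v : Rn n))

/-- The supremum `C*` of the constants `c` for which there is `V ∈ limitSpaces L 𝒞` such that `T` is
almost everywhere equal to `c` on `μ₀ + V` for some `μ₀ ∈ M₀`; it is `-∞` if there are none. -/
def cStar {n : ℕ} (M₀ : Set (Rn n)) (L : Submodule ℝ (Rn n)) (𝒞 : Set (Matrix (Fin n) (Fin n) ℝ))
    (T : Rn n → ℝ) : EReal :=
  sSup {x : EReal | ∃ c : ℝ, x = (c : EReal) ∧ ∃ V ∈ limitSpaces L 𝒞, ∃ μ₀ ∈ M₀,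
    ∀ᵐ y ∂(affineLebesgue μ₀ V), T y = c}

/-- `α* = sup_{C > C*} size(C)`. -/
def alphaStar {n : ℕ} (M₀ : Set (Rn n)) (L : Submodule ℝ (Rn n))
    (𝒞 : Set (Matrix (Fin n) (Fin n) ℝ)) (T : Rn n → ℝ) : ℝ≥0∞ :=
  ⨆ C ∈ {C : ℝ | cStar M₀ L 𝒞 T < (C : EReal)}, size M₀ 𝒞 T C

end Eicker

end

open Eicker

/-! The statistic is unchanged by translations along `nullDir X R` and by nonzero rescaling. With
`Π` the projection off that space, a rejection probability therefore depends only on `Π √Σ`, scaled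
so that its square has Frobenius norm one. By `size_eq_supRej` the size is a supremum of `P(τ(A z) ≥
C)`, with `z` standard Gaussian, over a bounded set of matrices `A`. Limits of such `A` may be
degenerate, and `τ` is a quotient of polynomials that can be discontinuous only on `span(X)`.

Condition (1) keeps the limits away from `span(X)`. Let `e(ω)` have entries `exp(i j ω)`. The traces
of `Σ(f)` projected off `L = nullDir X R` and off `span(X)` are integrals against `f` of the squared
norms of the projections of `e(ω)`. Near each frequency `γ` the projection off `L` is `O(|ω -
γ|^ρ)`, and (1) says that the projection off `span(X)` vanishes there to no higher order. By
compactness the first squared norm is at most a constant times the second, and integration preserves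
the bound (`sum_quadForm_projPerp_le`). Hence no limit `A` has its range in `span(X)`
(`projPerp_mul_ne_zero`), and `A z` avoids `span(X)` almost surely, zero sets of nonzero polynomials
being Gaussian null.

Rejection probabilities are thus upper semicontinuous at the limits. If the size exceeded `α` for
every `C`, some limit `A` would satisfy `P(τ(A z) ≥ m) ≥ α` for all `m`, which is absurd for a
finite statistic (`exists_supRej_le`). For exact size, take the infimum of all `C` with size at most
`α`. The law of `τ(A z)` has no atoms when the range of `A` is all of `Lᗮ`
(`measure_centeredStat_eq_zero`), which gives size at most `α` there. For a limit of smaller rank an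
atom at `C` makes the statistic constant on a space counted in `C*`, so `C ≤ C*`
(`le_cStar_of_measure_ne_zero`). Above `C*` the size is therefore left-continuous; at or below `C*`
the bound `α ≤ α*` suffices. -/

noncomputable section

namespace Eicker

/-! ### Polynomial functions and their zero sets -/

/-- Real functions on `ℝ^ι` given by a polynomial in the coordinates. -/
def IsPoly {ι : Type} (g : (ι → ℝ) → ℝ) : Prop :=
  ∃ p : MvPolynomial ι ℝ, ∀ x, g x = MvPolynomial.eval x p

namespace IsPoly

variable {ι κ : Type} {g h : (ι → ℝ) → ℝ}

theorem const (c : ℝ) : IsPoly fun _ : ι → ℝ => c := ⟨MvPolynomial.C c, by simp⟩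

theorem coord (i : ι) : IsPoly fun x : ι → ℝ => x i := ⟨MvPolynomial.X i, by simp⟩

theorem mul (hg : IsPoly g) (hh : IsPoly h) : IsPoly fun x => g x * h x := by
  obtain ⟨p, hp⟩ := hg
  obtain ⟨s, hs⟩ := hh
  exact ⟨p * s, by simp [hp, hs]⟩

theorem sub (hg : IsPoly g) (hh : IsPoly h) : IsPoly fun x => g x - h x := by
  obtain ⟨p, hp⟩ := hg
  obtain ⟨s, hs⟩ := hh
  exact ⟨p - s, by simp [hp, hs]⟩

theorem sum {σ : Type} {s : Finset σ} {f : σ → (ι → ℝ) → ℝ} (hf : ∀ i, IsPoly (f i)) :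
    IsPoly fun x => ∑ i ∈ s, f i x := by
  choose p hp using hf
  exact ⟨∑ i ∈ s, p i, by simp [hp]⟩

theorem prod {σ : Type} {s : Finset σ} {f : σ → (ι → ℝ) → ℝ} (hf : ∀ i, IsPoly (f i)) :
    IsPoly fun x => ∏ i ∈ s, f i x := by
  choose p hp using hf
  exact ⟨∏ i ∈ s, p i, by simp [hp]⟩

theorem comp {f : κ → (ι → ℝ) → ℝ} {g : (κ → ℝ) → ℝ} (hg : IsPoly g) (hf : ∀ i, IsPoly (f i)) :
    IsPoly fun x => g fun i => f i x := by
  choose p hp using hf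
  obtain ⟨s, hs⟩ := hg
  refine ⟨MvPolynomial.bind₁ p s, fun x => ?_⟩
  change g (fun i => f i x) = _
  rw [hs, ← MvPolynomial.coe_aeval_eq_eval, ← MvPolynomial.coe_aeval_eq_eval]
  simp only [RingHom.coe_coe]
  rw [MvPolynomial.aeval_bind₁]
  congr 2
  ext i
  rw [hp, ← MvPolynomial.coe_aeval_eq_eval]
  rfl

theorem mulVec [Fintype κ] {σ : Type} (A : Matrix σ κ ℝ) {f : (ι → ℝ) → κ → ℝ}
    (hf : ∀ j, IsPoly fun x => f x j) (i : σ) : IsPoly fun x => (A *ᵥ f x) i :=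
  sum fun j => (const _).mul (hf j)

theorem matrixMul [Fintype κ] {σ τ : Type} {A : (ι → ℝ) → Matrix σ κ ℝ}
    {B : (ι → ℝ) → Matrix κ τ ℝ} (hA : ∀ i j, IsPoly fun x => A x i j)
    (hB : ∀ i j, IsPoly fun x => B x i j) (i : σ) (j : τ) : IsPoly fun x => (A x * B x) i j := by
  simp only [Matrix.mul_apply]
  exact sum fun l => (hA i l).mul (hB l j)

theorem det [Fintype κ] [DecidableEq κ] {A : (ι → ℝ) → Matrix κ κ ℝ}
    (hA : ∀ i j, IsPoly fun x => A x i j) : IsPoly fun x => (A x).det := by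
  simp only [Matrix.det_apply']
  exact sum fun s => (const _).mul (prod fun i => hA _ _)

theorem adjugate [Fintype κ] [DecidableEq κ] {A : (ι → ℝ) → Matrix κ κ ℝ}
    (hA : ∀ i j, IsPoly fun x => A x i j) (i j : κ) : IsPoly fun x => (A x).adjugate i j := by
  simp only [Matrix.adjugate_apply]
  refine det fun a b => ?_
  by_cases h : a = j
  · subst h
    simpa using const _
  · simpa [Matrix.updateRow_ne h] using hA a b

theorem continuous (hg : IsPoly g) : Continuous g := by
  obtain ⟨p, hp⟩ := hg
  rw [funext hp]
  exact MvPolynomial.continuous_eval p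

end IsPoly

/-- The zero set of a nonzero polynomial is null for every product of atomless measures. -/
theorem pi_eval_eq_zero_null (μ : Measure ℝ) [SigmaFinite μ] [NullSingletonClass μ] {n : ℕ}
    (p : MvPolynomial (Fin n) ℝ) (hp : p ≠ 0) :
    Measure.pi (fun _ : Fin n => μ) {x | MvPolynomial.eval x p = 0} = 0 := by
  induction n with
  | zero =>
    convert measure_empty (μ := Measure.pi (fun _ : Fin 0 => μ))
    ext x
    simp only [mem_ofPred_eq, mem_empty_iff_false, iff_false]
    intro h
    apply hp
    apply MvPolynomial.funext
    intro y
    rw [Subsingleton.elim y x, h, map_zero]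
  | succ n ih =>
    have hP := (MvPolynomial.finSuccEquiv ℝ n).map_ne_zero_iff.mpr hp
    -- View `p` as a polynomial in the first variable. Some coefficient is a nonzero polynomial in
    -- the others, hence nonzero almost everywhere by induction, and then only finitely many values
    -- of the first variable are roots.
    obtain ⟨d, hd⟩ : ∃ d, (MvPolynomial.finSuccEquiv ℝ n p).coeff d ≠ 0 := by
      by_contra! h
      exact hP (Polynomial.ext (by simpa using h))
    have hm := (measurePreserving_piFinSuccAbove (fun _ : Fin (n + 1) => μ) 0).symm
    have hms : MeasurableSet {x : Fin (n + 1) → ℝ | MvPolynomial.eval x p = 0} :=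
      (isClosed_singleton.preimage (MvPolynomial.continuous_eval p)).measurableSet
    rw [← hm.measure_preimage hms.nullMeasurableSet]
    -- The swap puts the remaining variables outside and the first variable inside the iterated
    -- integral.
    have hsw := (Measure.measurePreserving_swap
      (μ := Measure.pi (fun _ : Fin n => μ)) (ν := μ))
    rw [← hsw.measure_preimage ((hm.measurable hms).nullMeasurableSet)]
    rw [Measure.measure_prod_null (hsw.measurable (hm.measurable hms))]
    have h0 : ∀ᵐ y ∂Measure.pi (fun _ : Fin n => μ),
        MvPolynomial.eval y ((MvPolynomial.finSuccEquiv ℝ n p).coeff d) ≠ 0 := by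
      rw [ae_iff]
      simpa using ih _ hd
    filter_upwards [h0] with y hy
    have hne : Polynomial.map (MvPolynomial.eval y) (MvPolynomial.finSuccEquiv ℝ n p) ≠ 0 := by
      intro h
      apply hy
      rw [← Polynomial.coeff_map, h, Polynomial.coeff_zero]
    refine measure_mono_null (t := {t | (Polynomial.map (MvPolynomial.eval y)
      (MvPolynomial.finSuccEquiv ℝ n p)).IsRoot t}) ?_
      (Set.Finite.measure_zero (Polynomial.finite_setOfPred_isRoot hne) _)
    intro t ht
    have ht' : MvPolynomial.eval (Fin.insertNth 0 t y : Fin (n + 1) → ℝ) p = 0 := ht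
    rwa [Fin.insertNth_zero', MvPolynomial.eval_eq_eval_mv_eval'] at ht'

/-- The standard Gaussian measure on `ℝⁿ`, as a product measure. -/
abbrev gaussPi (n : ℕ) : Measure (Fin n → ℝ) := Measure.pi fun _ => gaussianReal 0 1

theorem IsPoly.gaussPi_null {n : ℕ} {g : (Fin n → ℝ) → ℝ} (hg : IsPoly g) {x : Fin n → ℝ}
    (hx : g x ≠ 0) : gaussPi n {z | g z = 0} = 0 := by
  obtain ⟨p, hp⟩ := hg
  have : NullSingletonClass (gaussianReal 0 1) := nullSingletonClass_gaussianReal (by simp)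
  simp only [hp]
  refine pi_eval_eq_zero_null _ p ?_
  rintro rfl
  exact hx (by rw [hp, map_zero])

/-! ### The projection onto the orthogonal complement -/

section projPerp

variable {n : ℕ} (L : Submodule ℝ (Rn n))

theorem projPerp_mulVec (x : Fin n → ℝ) :
    (WithLp.toLp 2 (projPerp L *ᵥ x) : Rn n) = Lᗮ.starProjection (WithLp.toLp 2 x) := by
  rw [← Matrix.toEuclideanCLM_toLp, projPerp, StarAlgEquiv.apply_symm_apply]

theorem projPerp_mulVec_eq_zero_iff (x : Fin n → ℝ) :
    projPerp L *ᵥ x = 0 ↔ (WithLp.toLp 2 x : Rn n) ∈ L := by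
  rw [← WithLp.toLp_eq_zero (p := 2), projPerp_mulVec, Submodule.starProjection_apply_eq_zero_iff,
    Submodule.orthogonal_orthogonal]

theorem projPerp_mulVec_eq_self_iff (x : Fin n → ℝ) :
    projPerp L *ᵥ x = x ↔ (WithLp.toLp 2 x : Rn n) ∈ Lᗮ := by
  rw [← Submodule.starProjection_eq_self_iff, ← projPerp_mulVec]
  exact (WithLp.toLp_injective 2).eq_iff.symm

theorem projPerp_mulVec_mem (x : Fin n → ℝ) :
    (WithLp.toLp 2 (projPerp L *ᵥ x) : Rn n) ∈ Lᗮ := by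
  rw [projPerp_mulVec]
  exact Submodule.starProjection_apply_mem _ _

theorem sub_projPerp_mulVec_mem (x : Fin n → ℝ) :
    (WithLp.toLp 2 (x - projPerp L *ᵥ x) : Rn n) ∈ L := by
  rw [← projPerp_mulVec_eq_zero_iff, Matrix.mulVec_sub, sub_eq_zero, eq_comm,
    projPerp_mulVec_eq_self_iff]
  exact projPerp_mulVec_mem L x

/-- The part removed by projecting off `L` lies in `L ≤ M`, which the projection off `M` kills. -/
theorem projPerp_mul_of_le {L M : Submodule ℝ (Rn n)} (h : L ≤ M) :
    projPerp M * projPerp L = projPerp M := by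
  refine Matrix.ext_of_mulVec_single fun i => ?_
  rw [← Matrix.mulVec_mulVec, ← sub_eq_zero, ← Matrix.mulVec_sub, projPerp_mulVec_eq_zero_iff,
    ← neg_sub, WithLp.toLp_neg]
  exact M.neg_mem (h (sub_projPerp_mulVec_mem L _))

theorem projPerp_transpose : (projPerp L)ᵀ = projPerp L := by
  have h : star (projPerp L) = projPerp L := by
    apply EquivLike.injective (Matrix.toEuclideanCLM (n := Fin n) (𝕜 := ℝ))
    rw [map_star (Matrix.toEuclideanCLM (n := Fin n) (𝕜 := ℝ)), projPerp,
      StarAlgEquiv.apply_symm_apply]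
    exact (Submodule.isSymmetricProjection_starProjection Lᗮ).isSymmetric.isSelfAdjoint
  rwa [Matrix.star_eq_conjTranspose, Matrix.conjTranspose_eq_transpose_of_trivial] at h

end projPerp

/-! ### Quadratic forms of spectral covariance matrices -/

section spectral

variable {n : ℕ}

/-- The squared modulus of the trigonometric polynomial `∑ x_j exp(i (j + 1) ω)`. -/
def trigQuad (x : Fin n → ℝ) (ω : ℝ) : ℝ :=
  (∑ j, x j * Real.cos (((j : ℕ) + 1) * ω)) ^ 2 + (∑ j, x j * Real.sin (((j : ℕ) + 1) * ω)) ^ 2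

theorem trigQuad_nonneg (x : Fin n → ℝ) (ω : ℝ) : 0 ≤ trigQuad x ω := by
  unfold trigQuad
  positivity

theorem trigQuad_neg (x : Fin n → ℝ) (ω : ℝ) : trigQuad x (-ω) = trigQuad x ω := by
  simp [trigQuad]

theorem continuous_trigQuad (x : Fin n → ℝ) : Continuous (trigQuad x) := by
  unfold trigQuad
  fun_prop

theorem trigQuad_eq_sum (x : Fin n → ℝ) (ω : ℝ) :
    trigQuad x ω = ∑ j : Fin n, ∑ l : Fin n,
      x j * x l * Real.cos ((((j : ℕ) : ℝ) - ((l : ℕ) : ℝ)) * ω) := by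
  rw [trigQuad, sq, sq, Finset.sum_mul_sum, Finset.sum_mul_sum, ← Finset.sum_add_distrib]
  refine Finset.sum_congr rfl fun j _ => ?_
  rw [← Finset.sum_add_distrib]
  refine Finset.sum_congr rfl fun l _ => ?_
  rw [show (((j : ℕ) : ℝ) - ((l : ℕ) : ℝ)) * ω = ((j : ℕ) + 1) * ω - ((l : ℕ) + 1) * ω by ring,
    Real.cos_sub]
  ring

theorem spectralCov_apply {f : ℝ → ℝ} (hf : IntervalIntegrable f volume (-Real.pi) Real.pi)
    (j l : Fin n) : spectralCov n f j l =
      ∫ ω in (-Real.pi)..Real.pi, Real.cos ((((j : ℕ) : ℝ) - ((l : ℕ) : ℝ)) * ω) * f ω := by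
  have hi : IntervalIntegrable (fun ω : ℝ =>
      Complex.exp (-(Complex.I * (((j : ℕ) : ℂ) - ((l : ℕ) : ℂ)) * (ω : ℂ))) * (f ω : ℂ))
      volume (-Real.pi) Real.pi :=
    IntervalIntegrable.continuousOn_mul (μ := volume) ⟨hf.1.ofReal, hf.2.ofReal⟩ (by fun_prop)
  have h := Complex.reCLM.intervalIntegral_comp_comm hi
  simp only [Complex.reCLM_apply] at h
  rw [spectralCov, Matrix.of_apply, ← h]
  congr 1
  ext ω
  rw [Complex.re_mul_ofReal]
  congr 1
  rw [show -(Complex.I * (((j : ℕ) : ℂ) - ((l : ℕ) : ℂ)) * (ω : ℂ))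
    = ((-((((j : ℕ) : ℝ) - ((l : ℕ) : ℝ)) * ω) : ℝ) : ℂ) * Complex.I by push_cast; ring,
    Complex.exp_ofReal_mul_I_re, Real.cos_neg]

/-- This reduces comparisons of covariance matrices, uniform over all spectral densities, to
pointwise comparisons of trigonometric polynomials. -/
theorem spectralCov_quadForm {f : ℝ → ℝ} (hf : IntervalIntegrable f volume (-Real.pi) Real.pi)
    (x : Fin n → ℝ) :
    x ⬝ᵥ (spectralCov n f *ᵥ x) = ∫ ω in (-Real.pi)..Real.pi, trigQuad x ω * f ω := by
  have hi : ∀ j l : Fin n, IntervalIntegrable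
      (fun ω => x j * x l * Real.cos ((((j : ℕ) : ℝ) - ((l : ℕ) : ℝ)) * ω) * f ω)
      volume (-Real.pi) Real.pi := fun j l => hf.continuousOn_mul (by fun_prop)
  simp only [trigQuad_eq_sum, Finset.sum_mul]
  rw [intervalIntegral.integral_finsetSum fun j _ => by
    simpa only [Finset.sum_fn] using IntervalIntegrable.sum Finset.univ fun l _ => hi j l]
  rw [dotProduct]
  refine Finset.sum_congr rfl fun j _ => ?_
  rw [intervalIntegral.integral_finsetSum fun l _ => hi j l]
  rw [Matrix.mulVec, dotProduct, Finset.mul_sum]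
  refine Finset.sum_congr rfl fun l _ => ?_
  rw [spectralCov_apply hf]
  simp only [mul_assoc]
  rw [intervalIntegral.integral_const_mul, intervalIntegral.integral_const_mul]
  ring

theorem spectralCov_isHermitian {f : ℝ → ℝ}
    (hf : IntervalIntegrable f volume (-Real.pi) Real.pi) : (spectralCov n f).IsHermitian := by
  refine Matrix.IsHermitian.ext fun i j => ?_
  rw [star_trivial, spectralCov_apply hf, spectralCov_apply hf]
  congr 1
  ext ω
  rw [← Real.cos_neg]
  ring_nf

/-- The vector `(exp(i (j + 1) ω))_j`. -/
def expVec (n : ℕ) (ω : ℝ) : Fin n → ℂ := fun j => Complex.exp ((((j : ℕ) : ℂ) + 1) * ω * Complex.I)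

theorem sum_mul_expVec (x : Fin n → ℝ) (ω : ℝ) :
    ∑ j, (x j : ℂ) * expVec n ω j =
      ⟨∑ j, x j * Real.cos (((j : ℕ) + 1) * ω), ∑ j, x j * Real.sin (((j : ℕ) + 1) * ω)⟩ := by
  have h : ∀ j : Fin n, expVec n ω j =
      Complex.exp (((((j : ℕ) + 1) * ω : ℝ) : ℂ) * Complex.I) := by
    intro j
    simp [expVec]
  simp only [h]
  apply Complex.ext
  · simp [Complex.re_sum, Complex.exp_ofReal_mul_I_re, -Complex.ofReal_mul, -Complex.ofReal_add]
  · simp [Complex.im_sum, Complex.exp_ofReal_mul_I_im, -Complex.ofReal_mul, -Complex.ofReal_add]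

theorem trigQuad_eq_normSq (x : Fin n → ℝ) (ω : ℝ) :
    trigQuad x ω = ‖∑ j, (x j : ℂ) * expVec n ω j‖ ^ 2 := by
  rw [sum_mul_expVec, Complex.sq_norm, Complex.normSq_mk, trigQuad]
  ring

/-- Zeros correspond to roots on the unit circle of the nonzero polynomial `∑ x_j z^(j+1)`. The
half-open interval makes `ω ↦ exp(iω)` injective. -/
theorem finite_trigQuad_eq_zero {x : Fin n → ℝ} (hx : x ≠ 0) :
    {ω ∈ Ioc (-Real.pi) Real.pi | trigQuad x ω = 0}.Finite := by
  set p : Polynomial ℂ := ∑ j : Fin n, Polynomial.monomial ((j : ℕ) + 1) (x j : ℂ) with hpdef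
  have hp : p ≠ 0 := by
    intro h
    apply hx
    ext j
    have := congrArg (fun p => Polynomial.coeff p ((j : ℕ) + 1)) h
    simp only [hpdef, Polynomial.finsetSum_coeff, Polynomial.coeff_monomial,
      Polynomial.coeff_zero, add_left_inj, Fin.val_inj] at this
    simpa using this
  have hinj : InjOn (fun ω : ℝ => Complex.exp (ω * Complex.I)) (Ioc (-Real.pi) Real.pi) := by
    intro a ha b hb hab
    have := congrArg Complex.arg hab
    simp only [Complex.arg_exp_mul_I] at this
    rwa [(toIocMod_eq_self _).2, (toIocMod_eq_self _).2] at this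
    · rwa [show -Real.pi + 2 * Real.pi = Real.pi by ring]
    · rwa [show -Real.pi + 2 * Real.pi = Real.pi by ring]
  refine Set.Finite.subset (Set.Finite.preimage (s := {z | p.IsRoot z})
    (f := fun ω : {ω // ω ∈ Ioc (-Real.pi) Real.pi} => Complex.exp ((ω : ℝ) * Complex.I))
    (fun a _ b _ h => Subtype.ext (hinj a.2 b.2 h))
    (Polynomial.finite_setOfPred_isRoot hp) |>.image Subtype.val) ?_
  rintro ω ⟨h1, h2⟩
  refine ⟨⟨ω, h1⟩, ?_, rfl⟩
  rw [trigQuad_eq_normSq, sq_eq_zero_iff, norm_eq_zero] at h2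
  change p.eval _ = 0
  rw [← h2, hpdef, Polynomial.eval_finsetSum]
  refine Finset.sum_congr rfl fun j _ => ?_
  rw [Polynomial.eval_monomial, expVec, ← Complex.exp_nat_mul]
  push_cast
  ring_nf

/-- A vanishing quadratic form would force `f = 0` almost everywhere, since `trigQuad x` has
finitely many zeros; this contradicts the unit integral. -/
theorem spectralCov_posDef {f : ℝ → ℝ} (hf : f ∈ normalizedSpectralDensities) :
    (spectralCov n f).PosDef := by
  obtain ⟨h0, -, hi, h1⟩ := hf
  refine Matrix.PosDef.of_dotProduct_mulVec_pos (spectralCov_isHermitian hi) fun x hx => ?_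
  have hpi : -Real.pi ≤ Real.pi := by linarith [Real.pi_pos]
  rw [star_trivial, spectralCov_quadForm hi]
  have hnn : ∀ ω ∈ Icc (-Real.pi) Real.pi, 0 ≤ trigQuad x ω * f ω := fun ω hω =>
    mul_nonneg (trigQuad_nonneg x ω) (h0 ω hω)
  refine lt_of_le_of_ne (intervalIntegral.integral_nonneg hpi hnn) fun h => ?_
  have hint : IntervalIntegrable (fun ω => trigQuad x ω * f ω) volume (-Real.pi) Real.pi :=
    hi.continuousOn_mul (continuous_trigQuad x).continuousOn
  have h2 := (intervalIntegral.integral_eq_zero_iff_of_le_of_nonneg_ae hpi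
    ((ae_restrict_iff' measurableSet_Ioc).2 (ae_of_all _ fun ω hω =>
      hnn ω (Ioc_subset_Icc_self hω))) hint).1 h.symm
  have h3 : f =ᵐ[volume.restrict (Ioc (-Real.pi) Real.pi)] 0 := by
    rw [Filter.EventuallyEq, ae_restrict_iff' measurableSet_Ioc] at h2 ⊢
    have h4 : ∀ᵐ ω ∂(volume : Measure ℝ), ω ∉ {ω ∈ Ioc (-Real.pi) Real.pi | trigQuad x ω = 0} :=
      measure_eq_zero_iff_ae_notMem.1 ((finite_trigQuad_eq_zero hx).measure_zero _)
    filter_upwards [h2, h4] with ω hω hω' hm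
    have := hω hm
    simp only [Pi.zero_apply, mul_eq_zero] at this
    exact this.resolve_left fun h => hω' ⟨hm, h⟩
  rw [intervalIntegral.integral_of_le hpi, integral_congr_ae h3] at h1
  simp at h1

/-! ### Comparing two projected exponential vectors -/

/-- The `s`-th derivative of `expVec` up to a power of `i`. -/
def expDeriv (n s : ℕ) (ω : ℝ) : Fin n → ℂ := fun j => (((j : ℕ) : ℂ) + 1) ^ s * expVec n ω j

-- In each coordinate, `exp(i(j+1)ω)` is `exp(i(j+1)γ)` times `exp(z)` with `z = i(j+1)(ω - γ)`, and
-- the exponential series is truncated at `z^m`.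
open Asymptotics Topology Filter in
theorem expVec_taylor (γ : ℝ) (m : ℕ) :
    (fun ω => expVec n ω - ∑ s ∈ Finset.range m,
      (((((ω - γ : ℝ) : ℂ) * Complex.I) ^ s / (s.factorial : ℂ)) • expDeriv n s γ))
      =O[𝓝 γ] fun ω : ℝ => (ω - γ) ^ m := by
  rw [isBigO_pi]
  intro j
  set z : ℝ → ℂ := fun ω => (((j : ℕ) : ℂ) + 1) * (((ω - γ : ℝ) : ℂ) * Complex.I) with hz
  have hz0 : Tendsto z (𝓝 γ) (𝓝 0) := by
    have : Continuous z := by fun_prop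
    simpa [hz] using this.tendsto γ
  have h1 := (Complex.exp_sub_sum_range_isBigO_pow m).comp_tendsto hz0
  have h2 : (fun ω => z ω ^ m) =O[𝓝 γ] fun ω : ℝ => (ω - γ) ^ m := by
    refine IsBigO.pow (IsBigO.of_bound (((j : ℕ) : ℝ) + 1) (Eventually.of_forall fun ω => ?_)) m
    have : ‖(((j : ℕ) : ℂ) + 1)‖ = ((j : ℕ) : ℝ) + 1 := by
      rw [← Nat.cast_one, ← Nat.cast_add, Complex.norm_natCast]
      push_cast
      rfl
    simp only [hz, norm_mul, Complex.norm_I, mul_one, Complex.norm_real, this]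
    exact le_rfl
  refine ((h1.trans h2).const_mul_left (expVec n γ j)).congr_left fun ω => ?_
  simp only [Function.comp_apply, Pi.sub_apply, Finset.sum_apply, Pi.smul_apply, smul_eq_mul,
    expDeriv, mul_sub, Finset.mul_sum]
  congr 1
  · rw [expVec, expVec, ← Complex.exp_add, hz]
    push_cast
    ring_nf
  · refine Finset.sum_congr rfl fun s _ => ?_
    rw [hz, mul_pow]
    ring

/-- The image of `expVec` under a real matrix. -/
def projExp (P : Matrix (Fin n) (Fin n) ℝ) (ω : ℝ) : Fin n → ℂ :=
  P.map Complex.ofReal *ᵥ expVec n ω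

-- The first `m` Taylor terms vanish under `P`, hence under `Q = Q P`. The next one survives under
-- `Q`, so `projExp Q` is at least of the order `|ω - γ|^m`, while `projExp P` is at most of that
-- order.
open Asymptotics Topology Filter in
theorem projExp_isBigO {P Q : Matrix (Fin n) (Fin n) ℝ} (hQP : Q * P = Q) {γ : ℝ} {m : ℕ}
    (hP : ∀ s < m, P.map Complex.ofReal *ᵥ expDeriv n s γ = 0)
    (hQ : Q.map Complex.ofReal *ᵥ expDeriv n m γ ≠ 0) :
    projExp P =O[𝓝 γ] projExp Q := by
  have key : ∀ (M : Matrix (Fin n) (Fin n) ℝ) (m : ℕ),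
      (fun ω => projExp M ω - ∑ s ∈ Finset.range m, (((((ω - γ : ℝ) : ℂ) * Complex.I) ^ s /
        (s.factorial : ℂ)) • (M.map Complex.ofReal *ᵥ expDeriv n s γ)))
      =O[𝓝 γ] fun ω : ℝ => (ω - γ) ^ m := by
    intro M m
    have h := ((LinearMap.toContinuousLinearMap (Matrix.mulVecLin
      (M.map Complex.ofReal))).isBigO_comp (fun ω => expVec n ω - ∑ s ∈ Finset.range m,
      (((((ω - γ : ℝ) : ℂ) * Complex.I) ^ s / (s.factorial : ℂ)) • expDeriv n s γ)) (𝓝 γ)).trans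
      (expVec_taylor γ m)
    refine h.congr_left fun ω => ?_
    rw [map_sub, map_sum]
    simp only [map_smul]
    rfl
  have hQ0 : ∀ s < m, Q.map Complex.ofReal *ᵥ expDeriv n s γ = 0 := by
    intro s hs
    have : Q.map Complex.ofReal * P.map Complex.ofReal = Q.map Complex.ofReal := by
      conv_rhs => rw [← hQP]
      exact (Matrix.map_mul (f := Complex.ofRealHom)).symm
    rw [← this, ← Matrix.mulVec_mulVec, hP s hs, Matrix.mulVec_zero]
  have h1 : projExp P =O[𝓝 γ] fun ω : ℝ => (ω - γ) ^ m := by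
    refine (key P m).congr_left fun ω => ?_
    rw [Finset.sum_eq_zero, sub_zero]
    intro s hs
    rw [hP s (Finset.mem_range.1 hs), smul_zero]
  set v := Q.map Complex.ofReal *ᵥ expDeriv n m γ with hv
  set h : ℝ → Fin n → ℂ := fun ω =>
    ((((ω - γ : ℝ) : ℂ) * Complex.I) ^ m / (m.factorial : ℂ)) • v with hh
  have h2 : (fun ω => projExp Q ω - h ω) =O[𝓝 γ] fun ω : ℝ => (ω - γ) ^ (m + 1) := by
    refine (key Q (m + 1)).congr_left fun ω => ?_
    rw [Finset.sum_range_succ, Finset.sum_eq_zero, zero_add]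
    intro s hs
    rw [hQ0 s (Finset.mem_range.1 hs), smul_zero]
  have h3 : (fun ω : ℝ => (ω - γ) ^ m) =O[𝓝 γ] h := by
    refine IsBigO.of_bound ((m.factorial : ℝ) / ‖v‖) (Eventually.of_forall fun ω => le_of_eq ?_)
    have hvp : ‖v‖ ≠ 0 := norm_ne_zero_iff.2 hQ
    have hm : (m.factorial : ℝ) ≠ 0 := by positivity
    simp only [hh, norm_smul, norm_div, norm_pow, norm_mul, Complex.norm_I, mul_one,
      Complex.norm_real, Complex.norm_natCast]
    field_simp
  have h4 : (fun ω : ℝ => (ω - γ) ^ (m + 1)) =o[𝓝 γ] fun ω : ℝ => (ω - γ) ^ m := by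
    have h0 : Tendsto (fun ω : ℝ => ω - γ) (𝓝 γ) (𝓝 0) := by
      have : Continuous fun ω : ℝ => ω - γ := by fun_prop
      simpa using this.tendsto γ
    exact (isLittleO_pow_pow (𝕜 := ℝ) (Nat.lt_succ_self m)).comp_tendsto h0
  have h5 : h =O[𝓝 γ] projExp Q := by
    refine ((h2.trans_isLittleO h4).trans_isBigO h3).right_isBigO_add.congr_right fun ω => ?_
    simp
  exact h1.trans (h3.trans h5)

theorem projExp_apply (P : Matrix (Fin n) (Fin n) ℝ) (ω : ℝ) (i : Fin n) :
    projExp P ω i = ∑ j, (P i j : ℂ) * expVec n ω j := rfl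

theorem sum_trigQuad_le {P Q : Matrix (Fin n) (Fin n) ℝ} (hQP : Q * P = Q)
    (h : ∀ γ ∈ Icc 0 Real.pi, ∃ m, (∀ s < m, P.map Complex.ofReal *ᵥ expDeriv n s γ = 0) ∧
      Q.map Complex.ofReal *ᵥ expDeriv n m γ ≠ 0) :
    ∃ C : ℝ, ∀ ω ∈ Icc (-Real.pi) Real.pi,
      ∑ i, trigQuad (P.row i) ω ≤ C * ∑ i, trigQuad (Q.row i) ω := by
  obtain ⟨C, hC⟩ : ∃ C : ℝ, ∀ ω ∈ Icc 0 Real.pi, ‖projExp P ω‖ ≤ C * ‖projExp Q ω‖ := by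
    -- The local bounds near each `γ` are glued by taking maxima of finitely many constants.
    refine isCompact_Icc.induction_on (p := fun s => ∃ C : ℝ, ∀ ω ∈ s,
      ‖projExp P ω‖ ≤ C * ‖projExp Q ω‖) ⟨0, by simp⟩ ?_ ?_ ?_
    · rintro s t hst ⟨C, hC⟩
      exact ⟨C, fun ω hω => hC ω (hst hω)⟩
    · rintro s t ⟨C, hC⟩ ⟨D, hD⟩
      refine ⟨max C D, fun ω hω => ?_⟩
      rcases hω with hω | hω
      · exact (hC ω hω).trans (mul_le_mul_of_nonneg_right (le_max_left _ _) (norm_nonneg _))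
      · exact (hD ω hω).trans (mul_le_mul_of_nonneg_right (le_max_right _ _) (norm_nonneg _))
    · intro γ hγ
      obtain ⟨m, hP, hQ⟩ := h γ hγ
      obtain ⟨C, hC⟩ := (projExp_isBigO hQP hP hQ).bound
      exact ⟨_, mem_nhdsWithin_of_mem_nhds hC, C, fun ω hω => hω⟩
  -- The factor `n` pays for the passage from the sup norm to the sum of squares.
  have hC' : ∀ ω ∈ Icc 0 Real.pi,
      ∑ i, trigQuad (P.row i) ω ≤ (n * C ^ 2) * ∑ i, trigQuad (Q.row i) ω := by
    intro ω hω
    simp only [trigQuad_eq_normSq, Matrix.row_apply, ← projExp_apply]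
    have h1 : ∀ i, ‖projExp P ω i‖ ^ 2 ≤ C ^ 2 * ‖projExp Q ω‖ ^ 2 := fun i => by
      rw [← mul_pow]
      exact pow_le_pow_left₀ (norm_nonneg _) ((norm_le_pi_norm _ i).trans (hC ω hω)) 2
    have h2 : ‖projExp Q ω‖ ^ 2 ≤ ∑ i, ‖projExp Q ω i‖ ^ 2 := by
      rw [← Real.le_sqrt (norm_nonneg _) (by positivity),
        pi_norm_le_iff_of_nonneg (Real.sqrt_nonneg _)]
      intro i
      rw [Real.le_sqrt (norm_nonneg _) (by positivity)]
      exact Finset.single_le_sum (f := fun i => ‖projExp Q ω i‖ ^ 2) (fun _ _ => by positivity)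
        (Finset.mem_univ i)
    calc ∑ i, ‖projExp P ω i‖ ^ 2 ≤ ∑ _i : Fin n, C ^ 2 * ‖projExp Q ω‖ ^ 2 :=
          Finset.sum_le_sum fun i _ => h1 i
      _ = n * C ^ 2 * ‖projExp Q ω‖ ^ 2 := by simp [mul_assoc]
      _ ≤ _ := mul_le_mul_of_nonneg_left h2 (by positivity)
  refine ⟨n * C ^ 2, fun ω hω => ?_⟩
  rcases le_total 0 ω with h0 | h0
  · exact hC' ω ⟨h0, hω.2⟩
  · simpa only [trigQuad_neg] using hC' (-ω) ⟨by linarith, by linarith [hω.1]⟩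

theorem map_ofReal_mulVec_expDeriv (M : Matrix (Fin n) (Fin n) ℝ) (s : ℕ) (γ : ℝ) (i : Fin n) :
    (M.map Complex.ofReal *ᵥ expDeriv n s γ) i =
      ⟨(M *ᵥ fun j => trigMatrix n s γ j 0) i, (M *ᵥ fun j => trigMatrix n s γ j 1) i⟩ := by
  have h : ∀ j : Fin n, expDeriv n s γ j =
      (((((j : ℕ) : ℝ) + 1) ^ s : ℝ) : ℂ) *
        Complex.exp (((((j : ℕ) + 1) * γ : ℝ) : ℂ) * Complex.I) := by
    intro j
    simp [expDeriv, expVec]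
  simp only [Matrix.mulVec, dotProduct, Matrix.map_apply, h]
  apply Complex.ext
  · simp [Complex.re_sum, Complex.exp_ofReal_mul_I_re, -Complex.ofReal_mul, -Complex.ofReal_add,
      -Complex.ofReal_pow, trigMatrix]
  · simp [Complex.im_sum, Complex.exp_ofReal_mul_I_im, -Complex.ofReal_mul, -Complex.ofReal_add,
      -Complex.ofReal_pow, trigMatrix]

/-- The real and imaginary parts of `expDeriv n s γ` are the two columns of `trigMatrix n s γ`. -/
theorem projPerp_mulVec_expDeriv_eq_zero_iff (L : Submodule ℝ (Rn n)) (s : ℕ) (γ : ℝ) :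
    (projPerp L).map Complex.ofReal *ᵥ expDeriv n s γ = 0 ↔ colSpan (trigMatrix n s γ) ≤ L := by
  rw [colSpan, Submodule.span_le, range_subset_iff, Fin.forall_fin_two]
  simp only [SetLike.mem_coe]
  rw [← projPerp_mulVec_eq_zero_iff, ← projPerp_mulVec_eq_zero_iff, funext_iff, funext_iff,
    funext_iff, ← forall_and]
  refine forall_congr' fun i => ?_
  rw [map_ofReal_mulVec_expDeriv, Complex.ext_iff]
  rfl

/-! ### Traces of projected covariance matrices. -/

theorem trace_mul_mul_transpose (P S : Matrix (Fin n) (Fin n) ℝ) :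
    (P * S * Pᵀ).trace = ∑ i, P.row i ⬝ᵥ (S *ᵥ P.row i) := by
  rw [Matrix.trace]
  refine Finset.sum_congr rfl fun i _ => ?_
  rw [Matrix.diag_apply, Matrix.mul_assoc, Matrix.mul_apply]
  rfl

theorem trace_conj_spectralCov {f : ℝ → ℝ}
    (hf : IntervalIntegrable f volume (-Real.pi) Real.pi) (P : Matrix (Fin n) (Fin n) ℝ) :
    IntervalIntegrable (fun ω => (∑ i, trigQuad (P.row i) ω) * f ω) volume (-Real.pi) Real.pi ∧
    (P * spectralCov n f * Pᵀ).trace =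
      ∫ ω in (-Real.pi)..Real.pi, (∑ i, trigQuad (P.row i) ω) * f ω := by
  have hint : ∀ x : Fin n → ℝ,
      IntervalIntegrable (fun ω => trigQuad x ω * f ω) volume (-Real.pi) Real.pi :=
    fun x => hf.continuousOn_mul (continuous_trigQuad x).continuousOn
  refine ⟨hf.continuousOn_mul
    (continuous_finsetSum _ fun i _ => continuous_trigQuad (P.row i)).continuousOn, ?_⟩
  simp only [trace_mul_mul_transpose, spectralCov_quadForm hf, Finset.sum_mul]
  rw [intervalIntegral.integral_finsetSum fun i _ => hint _]

/-- If at every frequency `γ` the first of the matrices `E_{n,s}(γ)` that leaves `L` also leaves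
`M ⊇ L`, then the quadratic forms of spectral covariance matrices on `Lᗮ` are controlled by
those on `Mᗮ`. -/
theorem sum_quadForm_projPerp_le {L M : Submodule ℝ (Rn n)} (hLM : L ≤ M)
    (h : ∀ γ ∈ Icc (0 : ℝ) Real.pi, ¬ colSpan (trigMatrix n (rho γ L) γ) ≤ M) :
    ∃ C : ℝ, ∀ f ∈ normalizedSpectralDensities,
      (projPerp L * spectralCov n f * (projPerp L)ᵀ).trace ≤
        C * (projPerp M * spectralCov n f * (projPerp M)ᵀ).trace := by
  obtain ⟨C, hC⟩ := sum_trigQuad_le (projPerp_mul_of_le hLM) fun γ hγ => by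
    refine ⟨rho γ L, fun s hs => ?_, ?_⟩
    · rw [projPerp_mulVec_expDeriv_eq_zero_iff]
      by_contra hcon
      exact Nat.notMem_of_lt_sInf hs hcon
    · rw [Ne, projPerp_mulVec_expDeriv_eq_zero_iff]
      exact h γ hγ
  refine ⟨C, fun f hf => ?_⟩
  obtain ⟨h0, -, hi, -⟩ := hf
  obtain ⟨h1, h2⟩ := trace_conj_spectralCov hi (projPerp L)
  obtain ⟨h3, h4⟩ := trace_conj_spectralCov hi (projPerp M)
  rw [h2, h4, ← intervalIntegral.integral_const_mul]
  refine intervalIntegral.integral_mono_on (by linarith [Real.pi_pos]) h1 (h3.const_mul C)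
    fun ω hω => ?_
  rw [← mul_assoc]
  exact mul_le_mul_of_nonneg_right (hC ω hω) (h0 ω hω)

theorem covModel_nonempty (n : ℕ) : (covModel n normalizedSpectralDensities).Nonempty := by
  refine Set.Nonempty.image _ ⟨fun _ => (2 * Real.pi)⁻¹, fun _ _ => by positivity, fun _ _ => rfl,
    intervalIntegrable_const, ?_⟩
  rw [intervalIntegral.integral_const, smul_eq_mul,
    show Real.pi - -Real.pi = 2 * Real.pi by ring]
  exact mul_inv_cancel₀ (by positivity)

end spectral

/-! ### The weighted Eicker statistic -/

theorem mulVec_injective_of_rank {m k : ℕ} {X : Matrix (Fin m) (Fin k) ℝ} (hX : X.rank = k) :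
    Function.Injective X.mulVec := by
  have h := X.mulVecLin.finrank_range_add_finrank_ker
  rw [show Module.finrank ℝ (LinearMap.range X.mulVecLin) = k from hX, Module.finrank_fin_fun,
    Nat.add_eq_left, Submodule.finrank_eq_zero] at h
  exact LinearMap.ker_eq_bot.1 h

theorem mulVec_surjective_of_rank {q k : ℕ} {R : Matrix (Fin q) (Fin k) ℝ} (hR : R.rank = q) :
    Function.Surjective R.mulVec := by
  have h : LinearMap.range R.mulVecLin = ⊤ :=
    Submodule.eq_top_of_finrank_eq (by rw [Module.finrank_fin_fun]; exact hR)
  exact LinearMap.range_eq_top.1 h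

theorem vecMul_injective_of_rank {q k : ℕ} {R : Matrix (Fin q) (Fin k) ℝ} (hR : R.rank = q) :
    Function.Injective R.vecMul := by
  have h := mulVec_injective_of_rank (X := Rᵀ) (by rw [Matrix.rank_transpose, hR])
  intro x y hxy
  apply h
  simpa only [Matrix.mulVec_transpose] using hxy

/-- The Toeplitz matrix of empirical autocovariances of a vector is positive definite unless the
vector vanishes. -/
theorem posDef_autocov {n : ℕ} {u : Fin n → ℝ} (hu : u ≠ 0) :
    (Matrix.of fun i j : Fin n => (n : ℝ)⁻¹ * ∑ l : Fin n, ∑ m : Fin n,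
      if (l : ℕ) = (m : ℕ) + (((i : ℕ) : ℤ) - ((j : ℕ) : ℤ)).natAbs
      then u l * u m else 0).PosDef := by
  -- `U` is the matrix of convolution with `u`, and the autocovariance matrix is `n⁻¹ U'U`. Since `l
  -- + i ≤ 2n - 2`, `2n` rows suffice.
  set U : Matrix (Fin (2 * n)) (Fin n) ℝ :=
    Matrix.of fun t i => ∑ l : Fin n, if (t : ℕ) = l + i then u l else 0 with hU
  have hinj : Function.Injective U.mulVec := by
    refine (injective_iff_map_eq_zero U.mulVecLin).2 fun x hx => ?_
    set p : Polynomial ℝ := ∑ l : Fin n, Polynomial.monomial (l : ℕ) (u l)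
    set s : Polynomial ℝ := ∑ i : Fin n, Polynomial.monomial (i : ℕ) (x i)
    have hcoef : ∀ (y : Fin n → ℝ) (i : Fin n),
        (∑ l : Fin n, Polynomial.monomial (l : ℕ) (y l)).coeff (i : ℕ) = y i := by
      intro y i
      simp [Polynomial.coeff_monomial, Fin.val_inj]
    -- Convolution is multiplication of polynomials, so injectivity of `U` follows from the absence
    -- of zero divisors.
    have hps : p * s = 0 := by
      ext t
      simp only [p, s, Finset.sum_mul_sum, Polynomial.monomial_mul_monomial,
        Polynomial.finsetSum_coeff, Polynomial.coeff_monomial, Polynomial.coeff_zero]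
      by_cases ht : t < 2 * n
      · have := congrFun hx ⟨t, ht⟩
        simp only [Matrix.mulVecLin_apply, Matrix.mulVec, dotProduct, hU, Matrix.of_apply,
          Pi.zero_apply, Finset.sum_mul, ite_mul, zero_mul] at this
        rw [Finset.sum_comm]
        refine Eq.trans ?_ this
        refine Finset.sum_congr rfl fun i _ => Finset.sum_congr rfl fun l _ => ?_
        simp only [eq_comm]
      · refine Finset.sum_eq_zero fun l _ => Finset.sum_eq_zero fun i _ => if_neg ?_
        omega
    have hp : p ≠ 0 := by
      intro h
      apply hu
      ext i
      rw [← hcoef u i]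
      exact (congrArg (fun p => Polynomial.coeff p (i : ℕ)) h).trans (by simp)
    have hs := (mul_eq_zero.1 hps).resolve_left hp
    ext i
    rw [← hcoef x i]
    exact (congrArg (fun p => Polynomial.coeff p (i : ℕ)) hs).trans (by simp)
  have hn : 0 < (n : ℝ)⁻¹ := by
    rcases Nat.eq_zero_or_pos n with rfl | h
    · exact absurd (Subsingleton.elim _ _) hu
    · positivity
  convert (Matrix.PosDef.conjTranspose_mul_self U hinj).smul hn using 1
  ext i j
  simp only [Matrix.of_apply, Matrix.smul_apply, smul_eq_mul, Matrix.mul_apply,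
    Matrix.conjTranspose_apply, star_trivial, hU]
  congr 1
  have h1 : ∀ (l m : Fin n), (∑ t : Fin (2 * n), (if (t : ℕ) = l + i then u l else 0) *
      (if (t : ℕ) = m + j then u m else 0)) =
      if (l : ℕ) + i = m + j then u l * u m else 0 := by
    intro l m
    rw [Finset.sum_eq_single (⟨l + i, by omega⟩ : Fin (2 * n))]
    · simp
    · intro t _ ht
      rw [if_neg, zero_mul]
      exact fun h => ht (Fin.ext h)
    · simp
  have h2 : (∑ t : Fin (2 * n), (∑ l : Fin n, if (t : ℕ) = l + i then u l else 0) *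
      (∑ m : Fin n, if (t : ℕ) = m + j then u m else 0)) =
      ∑ l : Fin n, ∑ m : Fin n, if (l : ℕ) + i = m + j then u l * u m else 0 := by
    simp only [Finset.sum_mul_sum]
    rw [Finset.sum_comm]
    refine Finset.sum_congr rfl fun l _ => ?_
    rw [Finset.sum_comm]
    exact Finset.sum_congr rfl fun m _ => h1 l m
  rw [h2]
  rcases le_total (i : ℕ) (j : ℕ) with hij | hij
  · refine Finset.sum_congr rfl fun l _ => Finset.sum_congr rfl fun m _ => if_congr ?_ rfl rfl
    omega
  · rw [Finset.sum_comm]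
    refine Finset.sum_congr rfl fun l _ => Finset.sum_congr rfl fun m _ =>
      if_congr ?_ (mul_comm _ _) rfl
    omega

-- With `W = B'B`, the quadratic form at `x` is the sum over the rows `b` of `B` of the form of `K`
-- at the entrywise product of `b` and `x`. A nonzero diagonal of `W` gives each coordinate a row
-- not vanishing there, so semidefiniteness of `W` is enough.
open scoped MatrixOrder in
theorem posDef_hadamard {n : ℕ} {K W : Matrix (Fin n) (Fin n) ℝ} (hK : K.PosDef)
    (hW : W.PosSemidef) (hd : ∀ i, W i i ≠ 0) : (Matrix.hadamard K W).PosDef := by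
  obtain ⟨B, rfl⟩ := CStarAlgebra.nonneg_iff_eq_star_mul_self.1 hW.nonneg
  rw [Matrix.star_eq_conjTranspose] at hW hd ⊢
  refine Matrix.PosDef.of_dotProduct_mulVec_pos (hK.1.hadamard hW.1) fun x hx => ?_
  have key : star x ⬝ᵥ (Matrix.hadamard K (Bᴴ * B) *ᵥ x) =
      ∑ l, (fun i => B l i * x i) ⬝ᵥ (K *ᵥ fun i => B l i * x i) := by
    simp only [dotProduct, Matrix.mulVec, Matrix.hadamard_apply, Matrix.mul_apply, star_trivial,
      Matrix.conjTranspose_apply, Finset.mul_sum, Finset.sum_mul]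
    rw [Finset.sum_comm]
    conv_lhs => enter [2, j]; rw [Finset.sum_comm]
    rw [Finset.sum_comm]
    refine Finset.sum_congr rfl fun l _ => ?_
    rw [Finset.sum_comm]
    refine Finset.sum_congr rfl fun i _ => Finset.sum_congr rfl fun j _ => ?_
    ring
  obtain ⟨i, hi⟩ : ∃ i, x i ≠ 0 := Function.ne_iff.1 hx
  obtain ⟨l, hl⟩ : ∃ l, B l i ≠ 0 := by
    by_contra! h
    exact hd i (by simp [Matrix.mul_apply, h])
  rw [key]
  refine Finset.sum_pos' (fun l _ => ?_) ⟨l, Finset.mem_univ l, ?_⟩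
  · simpa using hK.posSemidef.dotProduct_mulVec_nonneg (fun i => B l i * x i)
  · simpa using hK.dotProduct_mulVec_pos (x := fun i => B l i * x i)
      (fun h => mul_ne_zero hl hi (congrFun h i))

section stat

variable {n k q : ℕ} {X : Matrix (Fin n) (Fin k) ℝ} {R : Matrix (Fin q) (Fin k) ℝ}
  {W : Matrix (Fin n) (Fin n) ℝ}

theorem mem_colSpan_iff {y : Rn n} :
    y ∈ colSpan X ↔ ∃ b : Fin k → ℝ, y = WithLp.toLp 2 (X *ᵥ b) := by
  rw [colSpan, Submodule.mem_span_range_iff_exists_fun]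
  refine exists_congr fun b => ?_
  rw [eq_comm]
  have : ∑ i, b i • (WithLp.toLp 2 (fun j => X j i) : Rn n) = WithLp.toLp 2 (X *ᵥ b) := by
    ext j
    simp [Matrix.mulVec, dotProduct, mul_comm]
  rw [this]

theorem nullDir_le_colSpan : nullDir X R ≤ colSpan X := by
  rintro _ ⟨b, rfl, -⟩
  exact mem_colSpan_iff.2 ⟨b, rfl⟩

theorem olsBeta_add (y z : Rn n) : olsBeta X (y + z) = olsBeta X y + olsBeta X z := by
  rw [olsBeta, olsBeta, olsBeta, ← Matrix.mulVec_add]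
  rfl

theorem olsBeta_smul (a : ℝ) (y : Rn n) : olsBeta X (a • y) = a • olsBeta X y := by
  rw [olsBeta, olsBeta, ← Matrix.mulVec_smul]
  rfl

theorem posDef_gram (hX : X.rank = k) : (Xᵀ * X).PosDef := by
  rw [← Matrix.conjTranspose_eq_transpose_of_trivial]
  exact Matrix.PosDef.conjTranspose_mul_self X (mulVec_injective_of_rank hX)

theorem olsBeta_mulVec (hX : X.rank = k) (b : Fin k → ℝ) :
    olsBeta X (WithLp.toLp 2 (X *ᵥ b)) = b := by
  change ((Xᵀ * X)⁻¹ * Xᵀ) *ᵥ (X *ᵥ b) = b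
  rw [Matrix.mulVec_mulVec, Matrix.mul_assoc, Matrix.nonsing_inv_mul _
    ((Matrix.isUnit_iff_isUnit_det _).1 (posDef_gram hX).isUnit), Matrix.one_mulVec]

theorem olsResid_add (y z : Rn n) : olsResid X (y + z) = olsResid X y + olsResid X z := by
  rw [olsResid, olsResid, olsResid, olsBeta_add, Matrix.mulVec_add]
  ext i
  simp only [Pi.sub_apply, Pi.add_apply, PiLp.add_apply]
  ring

theorem olsResid_smul (a : ℝ) (y : Rn n) : olsResid X (a • y) = a • olsResid X y := by
  rw [olsResid, olsResid, olsBeta_smul, Matrix.mulVec_smul, smul_sub]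
  rfl

theorem olsResid_eq_zero_iff (hX : X.rank = k) (y : Rn n) :
    olsResid X y = 0 ↔ y ∈ colSpan X := by
  rw [mem_colSpan_iff]
  constructor
  · intro h
    exact ⟨olsBeta X y, by rw [olsResid, sub_eq_zero] at h; rw [← h]⟩
  · rintro ⟨b, rfl⟩
    rw [olsResid, olsBeta_mulVec hX, sub_self]

theorem omegaHat_smul (a : ℝ) (y : Rn n) :
    omegaHat X R W (a • y) = a ^ 2 • omegaHat X R W y := by
  have h : residAutocov X (a • y) = a ^ 2 • residAutocov X y := by
    ext i j
    simp only [residAutocov, olsResid_smul, Matrix.of_apply, Matrix.smul_apply, smul_eq_mul,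
      Pi.smul_apply, Finset.mul_sum]
    refine Finset.sum_congr rfl fun l _ => Finset.sum_congr rfl fun m _ => ?_
    split_ifs
    · ring
    · ring
  have h2 : Matrix.hadamard (a ^ 2 • residAutocov X y) W =
      a ^ 2 • Matrix.hadamard (residAutocov X y) W := Matrix.smul_hadamard _ _ _
  rw [omegaHat, omegaHat, psiHat, psiHat, h, h2]
  simp only [Matrix.mul_smul, Matrix.smul_mul]
  rw [smul_comm (a ^ 2) ((n : ℝ)), smul_comm (a ^ 2) ((n : ℝ)⁻¹)]

theorem omegaHat_congr {y z : Rn n} (h : olsResid X y = olsResid X z) :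
    omegaHat X R W y = omegaHat X R W z := by
  simp only [omegaHat, psiHat, residAutocov, h]

theorem omegaHat_posDef (hX : X.rank = k) (hR : R.rank = q) (hW : IsWeightMatrix W) {y : Rn n}
    (hy : y ∉ colSpan X) : (omegaHat X R W y).PosDef := by
  have hu : olsResid X y ≠ 0 := fun h => hy ((olsResid_eq_zero_iff hX y).1 h)
  have hn : 0 < (n : ℝ) := by
    rcases Nat.eq_zero_or_pos n with rfl | h
    · exact absurd (Subsingleton.elim _ _) hu
    · positivity
  have h1 : (Matrix.hadamard (residAutocov X y) W).PosDef :=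
    posDef_hadamard (posDef_autocov hu) hW.1 fun i => by simp [hW.2.2 i]
  have h2 : (psiHat X W y).PosDef := by
    have := h1.conjTranspose_mul_mul_same (mulVec_injective_of_rank hX)
    rw [Matrix.conjTranspose_eq_transpose_of_trivial] at this
    exact this.smul (inv_pos.2 hn)
  have hZ := (posDef_gram hX).inv
  have hinj : Function.Injective (R * (Xᵀ * X)⁻¹).vecMul := by
    have e : (R * (Xᵀ * X)⁻¹).vecMul = (Xᵀ * X)⁻¹.vecMul ∘ R.vecMul := by
      ext v
      simp [Function.comp, Matrix.vecMul_vecMul]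
    rw [e]
    exact (Matrix.vecMul_injective_of_isUnit hZ.isUnit).comp (vecMul_injective_of_rank hR)
  have h3 := (h2.mul_mul_conjTranspose_same hinj).smul hn
  rw [Matrix.conjTranspose_mul, hZ.1.eq, Matrix.conjTranspose_eq_transpose_of_trivial] at h3
  simpa only [omegaHat, Matrix.mul_assoc] using h3

theorem omegaHat_eq_zero (hX : X.rank = k) {y : Rn n} (hy : y ∈ colSpan X) :
    omegaHat X R W y = 0 := by
  have h := (olsResid_eq_zero_iff hX y).2 hy
  have : residAutocov X y = 0 := by
    ext i j
    simp [residAutocov, h]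
  have h2 : Matrix.hadamard (0 : Matrix (Fin n) (Fin n) ℝ) W = 0 := Matrix.zero_hadamard _
  simp [omegaHat, psiHat, this, h2]

theorem det_omegaHat_ne_zero_iff (hq : 1 ≤ q) (hX : X.rank = k) (hR : R.rank = q)
    (hW : IsWeightMatrix W) (y : Rn n) : (omegaHat X R W y).det ≠ 0 ↔ y ∉ colSpan X := by
  refine ⟨fun h hy => h ?_, fun hy => (omegaHat_posDef hX hR hW hy).det_pos.ne'⟩
  -- An empty determinant equals one, so `q ≥ 1` matters here.
  have : Nonempty (Fin q) := ⟨⟨0, hq⟩⟩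
  rw [omegaHat_eq_zero hX hy, Matrix.det_zero]

theorem eickerStat_null_add (hX : X.rank = k) {r : Fin q → ℝ} {μ : Rn n}
    (hμ : μ ∈ nullMeans X R r) (y : Rn n) :
    eickerStat X R r W (μ + y) = eickerStat X R 0 W y := by
  obtain ⟨b, rfl, hb⟩ := hμ
  have h1 : R *ᵥ olsBeta X (WithLp.toLp 2 (X *ᵥ b) + y) - r = R *ᵥ olsBeta X y - 0 := by
    rw [olsBeta_add, olsBeta_mulVec hX, Matrix.mulVec_add, hb]
    simp
  have h2 : omegaHat X R W (WithLp.toLp 2 (X *ᵥ b) + y) = omegaHat X R W y := by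
    apply omegaHat_congr
    rw [olsResid_add, (olsResid_eq_zero_iff hX _).2 (mem_colSpan_iff.2 ⟨b, rfl⟩), zero_add]
  rw [eickerStat, eickerStat, h1, h2]

/-- `β̂` is homogeneous of degree one and `Ω̂` of degree two, so the factors cancel. -/
theorem eickerStat_smul (a : ℝ) (ha : a ≠ 0) (y : Rn n) :
    eickerStat X R 0 W (a • y) = eickerStat X R 0 W y := by
  have hdet : (omegaHat X R W (a • y)).det ≠ 0 ↔ (omegaHat X R W y).det ≠ 0 := by
    rw [omegaHat_smul, Matrix.det_smul]
    simp [ha]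
  rw [eickerStat, eickerStat]
  by_cases h : (omegaHat X R W y).det ≠ 0
  · rw [if_pos h, if_pos (hdet.2 h), omegaHat_smul, olsBeta_smul]
    have : (a ^ 2 • omegaHat X R W y)⁻¹ = (a ^ 2)⁻¹ • (omegaHat X R W y)⁻¹ := by
      have hu : IsUnit (a ^ 2) := (pow_ne_zero 2 ha).isUnit
      exact Matrix.inv_eq_right_inv (by
        rw [Matrix.smul_mul, Matrix.mul_smul, smul_smul, mul_inv_cancel₀ hu.ne_zero, one_smul,
          Matrix.mul_nonsing_inv _ h.isUnit])
    rw [this]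
    simp only [Matrix.mulVec_smul, Matrix.smul_mulVec, sub_zero, dotProduct_smul, smul_dotProduct,
      smul_eq_mul]
    field_simp
  · rw [if_neg h, if_neg (fun h' => h (hdet.1 h'))]

theorem eickerStat_nonneg (hq : 1 ≤ q) (hX : X.rank = k) (hR : R.rank = q)
    (hW : IsWeightMatrix W) (y : Rn n) : 0 ≤ eickerStat X R 0 W y := by
  rw [eickerStat]
  split_ifs with h
  · have := (omegaHat_posDef hX hR hW ((det_omegaHat_ne_zero_iff hq hX hR hW y).1 h)).inv.posSemidef
    simpa using this.dotProduct_mulVec_nonneg (R *ᵥ olsBeta X y - 0)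
  · exact le_rfl

/-! ### The statistic as a quotient of polynomials. -/

variable (X R W) in
/-- The numerator of the statistic as a rational function. -/
def statNum (x : Fin n → ℝ) : ℝ :=
  (R *ᵥ olsBeta X (WithLp.toLp 2 x)) ⬝ᵥ
    ((omegaHat X R W (WithLp.toLp 2 x)).adjugate *ᵥ (R *ᵥ olsBeta X (WithLp.toLp 2 x)))

variable (X R W) in
/-- The denominator of the statistic as a rational function. -/
def statDen (x : Fin n → ℝ) : ℝ := (omegaHat X R W (WithLp.toLp 2 x)).det

theorem eickerStat_eq_div (x : Fin n → ℝ) :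
    eickerStat X R 0 W (WithLp.toLp 2 x) = statNum X R W x / statDen X R W x := by
  rw [eickerStat, statNum, statDen]
  split_ifs with h
  · rw [Matrix.inv_def, Ring.inverse_eq_inv', Matrix.smul_mulVec, dotProduct_smul, sub_zero,
      smul_eq_mul, div_eq_inv_mul]
  -- Division by zero returns zero, which is also the default value of the statistic.
  · rw [not_ne_iff.1 h, div_zero]

theorem isPoly_olsBeta (i : Fin k) :
    IsPoly fun x : Fin n → ℝ => olsBeta X (WithLp.toLp 2 x) i :=
  IsPoly.mulVec _ (fun j => IsPoly.coord j) i

theorem isPoly_omegaHat (i j : Fin q) :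
    IsPoly fun x : Fin n → ℝ => omegaHat X R W (WithLp.toLp 2 x) i j := by
  have hu : ∀ l : Fin n, IsPoly fun x : Fin n → ℝ => olsResid X (WithLp.toLp 2 x) l := fun l =>
    (IsPoly.coord l).sub (IsPoly.mulVec X (fun j => isPoly_olsBeta j) l)
  have hK : ∀ a b : Fin n, IsPoly fun x : Fin n → ℝ => residAutocov X (WithLp.toLp 2 x) a b := by
    intro a b
    refine (IsPoly.const _).mul (IsPoly.sum fun l => IsPoly.sum fun m => ?_)
    split_ifs
    · exact (hu l).mul (hu m)
    · exact IsPoly.const 0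
  have hP : ∀ a b : Fin k, IsPoly fun x : Fin n → ℝ => psiHat X W (WithLp.toLp 2 x) a b := by
    intro a b
    exact (IsPoly.const _).mul (IsPoly.matrixMul
      (A := fun x => Xᵀ * Matrix.hadamard (residAutocov X (WithLp.toLp 2 x)) W) (B := fun _ => X)
      (IsPoly.matrixMul (A := fun _ => Xᵀ)
        (B := fun x => Matrix.hadamard (residAutocov X (WithLp.toLp 2 x)) W)
        (fun _ _ => IsPoly.const _) fun a b => (hK a b).mul (IsPoly.const _))
      (fun _ _ => IsPoly.const _) a b)
  have h1 := IsPoly.matrixMul (A := fun _ => R * (Xᵀ * X)⁻¹)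
    (B := fun x : Fin n → ℝ => psiHat X W (WithLp.toLp 2 x)) (fun _ _ => IsPoly.const _) hP
  have h2 := IsPoly.matrixMul (B := fun _ => (Xᵀ * X)⁻¹) h1 (fun _ _ => IsPoly.const _)
  have h3 := IsPoly.matrixMul (B := fun _ => Rᵀ) h2 (fun _ _ => IsPoly.const _)
  exact (IsPoly.const _).mul (h3 i j)

theorem isPoly_statDen : IsPoly (statDen X R W) := IsPoly.det isPoly_omegaHat

theorem isPoly_statNum : IsPoly (statNum X R W) := by
  have hv : ∀ i, IsPoly fun x : Fin n → ℝ => (R *ᵥ olsBeta X (WithLp.toLp 2 x)) i :=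
    IsPoly.mulVec R isPoly_olsBeta
  unfold statNum
  simp only [dotProduct]
  refine IsPoly.sum fun i => (hv i).mul ?_
  have hA := IsPoly.adjugate (isPoly_omegaHat (X := X) (R := R) (W := W))
  change IsPoly fun x => ∑ j, (omegaHat X R W (WithLp.toLp 2 x)).adjugate i j *
    (R *ᵥ olsBeta X (WithLp.toLp 2 x)) j
  exact IsPoly.sum fun j => (hA i j).mul (hv j)

theorem measurable_eickerStat : Measurable (eickerStat X R 0 W) := by
  have h : eickerStat X R 0 W = fun y : Rn n => statNum X R W y.ofLp / statDen X R W y.ofLp :=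
    funext fun y => eickerStat_eq_div y.ofLp
  rw [h]
  exact ((isPoly_statNum.continuous.comp (PiLp.continuous_ofLp 2 _)).measurable).div
    (isPoly_statDen.continuous.comp (PiLp.continuous_ofLp 2 _)).measurable

theorem continuousAt_eickerStat {x : Fin n → ℝ} (hx : statDen X R W x ≠ 0) :
    ContinuousAt (fun x : Fin n → ℝ => eickerStat X R 0 W (WithLp.toLp 2 x)) x := by
  simp only [eickerStat_eq_div]
  exact isPoly_statNum.continuous.continuousAt.div isPoly_statDen.continuous.continuousAt hx

/-- The statistic is not constant off the column space of `X`. -/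
theorem eickerStat_not_const (hq : 1 ≤ q) (hkn : k < n) (hX : X.rank = k) (hR : R.rank = q)
    (hW : IsWeightMatrix W) (c : ℝ) : ∃ y : Rn n, y ∉ colSpan X ∧ eickerStat X R 0 W y ≠ c := by
  obtain ⟨y, hy⟩ : ∃ y : Rn n, y ∉ colSpan X := by
    by_contra! h
    have h1 : colSpan X = ⊤ := Submodule.eq_top_iff'.2 h
    have h2 := finrank_range_le_card (R := ℝ)
      (fun j : Fin k => (WithLp.toLp 2 (fun i => X i j) : Rn n))
    rw [Set.finrank, show Submodule.span ℝ (Set.range fun j : Fin k =>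
      (WithLp.toLp 2 (fun i => X i j) : Rn n)) = ⊤ from h1, finrank_top,
      finrank_euclideanSpace_fin, Fintype.card_fin] at h2
    omega
  obtain ⟨v, hv⟩ := mulVec_surjective_of_rank hR 1
  have hv0 : R *ᵥ v ≠ 0 := fun h => one_ne_zero (congrFun (hv.symm.trans h) ⟨0, hq⟩)
  -- The residual `u` has `β̂(u) = 0` and gives the value zero; adding `X v` with `R v ≠ 0` gives a
  -- positive value. One of the two differs from `c`.
  set u : Rn n := y - WithLp.toLp 2 (X *ᵥ olsBeta X y)
  have hmem : ∀ b : Fin k → ℝ, (WithLp.toLp 2 (X *ᵥ b) : Rn n) ∈ colSpan X := fun b =>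
    mem_colSpan_iff.2 ⟨b, rfl⟩
  have hu : u ∉ colSpan X := fun h => hy (by
    simpa [u] using (colSpan X).add_mem h (hmem (olsBeta X y)))
  have hub : olsBeta X u = 0 := by
    have h := olsBeta_add (X := X) u (WithLp.toLp 2 (X *ᵥ olsBeta X y))
    rw [olsBeta_mulVec hX, sub_add_cancel] at h
    exact left_eq_add.1 (by rwa [add_comm] at h)
  have h0 : eickerStat X R 0 W u = 0 := by
    rw [eickerStat, hub]
    simp
  have h1 : u + WithLp.toLp 2 (X *ᵥ v) ∉ colSpan X := fun h => hu (by
    simpa using (colSpan X).sub_mem h (hmem v))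
  have h2 : 0 < eickerStat X R 0 W (u + WithLp.toLp 2 (X *ᵥ v)) := by
    rw [eickerStat, if_pos ((det_omegaHat_ne_zero_iff hq hX hR hW _).2 h1), olsBeta_add, hub,
      olsBeta_mulVec hX, zero_add, sub_zero]
    simpa using (omegaHat_posDef hX hR hW h1).inv.dotProduct_mulVec_pos hv0
  by_cases hc : c = 0
  · exact ⟨_, h1, by rw [hc]; exact h2.ne'⟩
  · exact ⟨u, hu, by rw [h0]; exact Ne.symm hc⟩

end stat

/-! ### Suprema of Gaussian rejection probabilities -/

section rejection

open Filter Topology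

variable {n : ℕ}

/-- Allows limits of covariance roots to be handled by sequences. -/
instance : FirstCountableTopology (Matrix (Fin n) (Fin n) ℝ) :=
  inferInstanceAs (FirstCountableTopology (Fin n → Fin n → ℝ))

/-- The probability that `C ≤ τ (A z)` for a standard Gaussian vector `z`. -/
def rejProb (τ : (Fin n → ℝ) → ℝ) (A : Matrix (Fin n) (Fin n) ℝ) (C : ℝ) : ℝ≥0∞ :=
  gaussPi n {z | C ≤ τ (A *ᵥ z)}

/-- The supremum of `rejProb τ A C` over `A ∈ 𝒜`. -/
def supRej (τ : (Fin n → ℝ) → ℝ) (𝒜 : Set (Matrix (Fin n) (Fin n) ℝ)) (C : ℝ) : ℝ≥0∞ :=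
  ⨆ A ∈ 𝒜, rejProb τ A C

variable {τ : (Fin n → ℝ) → ℝ} {𝒜 : Set (Matrix (Fin n) (Fin n) ℝ)} {s : Set (Fin n → ℝ)}

theorem rejProb_anti (A : Matrix (Fin n) (Fin n) ℝ) : Antitone (rejProb τ A) :=
  fun _ _ h => measure_mono fun _ hz => h.trans hz

theorem supRej_anti : Antitone (supRej τ 𝒜) :=
  fun _ _ h => iSup₂_mono fun A _ => rejProb_anti A h

theorem continuous_mulVec_left (z : Fin n → ℝ) :
    Continuous fun A : Matrix (Fin n) (Fin n) ℝ => A *ᵥ z :=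
  continuous_id.matrix_mulVec continuous_const

theorem measurable_comp_mulVec (hτ : Measurable τ) (A : Matrix (Fin n) (Fin n) ℝ) :
    Measurable fun z => τ (A *ᵥ z) :=
  hτ.comp (Continuous.matrix_mulVec continuous_const continuous_id).measurable

theorem ae_tendsto_comp_mulVec (hc : ∀ x ∉ s, ContinuousAt τ x)
    {A : ℕ → Matrix (Fin n) (Fin n) ℝ} {A₀ : Matrix (Fin n) (Fin n) ℝ}
    (hA : Tendsto A atTop (𝓝 A₀)) (hs : ∀ᵐ z ∂gaussPi n, A₀ *ᵥ z ∉ s) :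
    ∀ᵐ z ∂gaussPi n, Tendsto (fun m => τ (A m *ᵥ z)) atTop (𝓝 (τ (A₀ *ᵥ z))) := by
  filter_upwards [hs] with z hz
  exact (hc _ hz).tendsto.comp (((continuous_mulVec_left z).tendsto A₀).comp hA)

/-- Reverse Fatou for events: if `C ≤ τ (A m z)` for infinitely many `m`, the closed inequality
survives in the limit. -/
theorem le_rejProb_of_tendsto (hτ : Measurable τ) (hc : ∀ x ∉ s, ContinuousAt τ x)
    {A : ℕ → Matrix (Fin n) (Fin n) ℝ} {A₀ : Matrix (Fin n) (Fin n) ℝ}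
    (hA : Tendsto A atTop (𝓝 A₀)) (hs : ∀ᵐ z ∂gaussPi n, A₀ *ᵥ z ∉ s) {C : ℝ} {β : ℝ≥0∞}
    (h : ∀ᶠ m in atTop, β ≤ rejProb τ (A m) C) : β ≤ rejProb τ A₀ C := by
  set E : ℕ → Set (Fin n → ℝ) := fun m => {z | C ≤ τ (A m *ᵥ z)}
  have hE : ∀ m, MeasurableSet (E m) := fun m =>
    measurableSet_le measurable_const (measurable_comp_mulVec hτ (A m))
  have hanti : Antitone fun m => ⋃ j ≥ m, E j := fun a b hab =>
    biUnion_subset_biUnion_left fun j hj => le_trans hab hj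
  have h1 : β ≤ gaussPi n (⋂ m, ⋃ j ≥ m, E j) := by
    rw [hanti.measure_iInter (fun m => (MeasurableSet.biUnion (to_countable _)
      fun j _ => hE j).nullMeasurableSet) ⟨0, measure_ne_top _ _⟩]
    refine le_iInf fun m => ?_
    obtain ⟨j, hj, hjm⟩ := (h.and (eventually_ge_atTop m)).exists
    exact hj.trans (measure_mono (subset_biUnion_of_mem (u := E) (show j ≥ m from hjm)))
  refine h1.trans (measure_mono_ae ?_)
  filter_upwards [ae_tendsto_comp_mulVec hc hA hs] with z hz hz'
  refine ge_of_tendsto_of_frequently hz (frequently_atTop.2 fun m => ?_)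
  obtain ⟨j, hj, hjz⟩ := mem_iUnion₂.1 (mem_iInter.1 hz' m)
  exact ⟨j, hj, hjz⟩

/-- Fatou for events: a strict inequality at the limit holds for all large `m`. -/
theorem measure_lt_le_of_tendsto (hc : ∀ x ∉ s, ContinuousAt τ x)
    {A : ℕ → Matrix (Fin n) (Fin n) ℝ} {A₀ : Matrix (Fin n) (Fin n) ℝ}
    (hA : Tendsto A atTop (𝓝 A₀)) (hs : ∀ᵐ z ∂gaussPi n, A₀ *ᵥ z ∉ s) {C : ℝ} {β : ℝ≥0∞}
    (h : ∀ m, rejProb τ (A m) C ≤ β) : gaussPi n {z | C < τ (A₀ *ᵥ z)} ≤ β := by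
  set E : ℕ → Set (Fin n → ℝ) := fun m => {z | C ≤ τ (A m *ᵥ z)}
  have hmono : Monotone fun m => ⋂ j ≥ m, E j := fun a b hab =>
    biInter_subset_biInter_left fun j hj => le_trans hab hj
  have h1 : gaussPi n (⋃ m, ⋂ j ≥ m, E j) ≤ β := by
    rw [hmono.measure_iUnion]
    exact iSup_le fun m => (measure_mono (biInter_subset_of_mem (show m ≥ m from le_rfl))).trans
      (h m)
  refine (measure_mono_ae ?_).trans h1
  filter_upwards [ae_tendsto_comp_mulVec hc hA hs] with z hz hz'
  obtain ⟨m, hm⟩ := eventually_atTop.1 (hz.eventually (lt_mem_nhds hz'))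
  exact mem_iUnion.2 ⟨m, mem_iInter₂.2 fun j hj => (hm j hj).le⟩

/-- Choose `A m` with rejection probability above `β` at `c m`, and pass to a convergent
subsequence. As `c` increases, later matrices also exceed `β` at each fixed earlier `c m`. -/
theorem exists_limit_le_rejProb (hτ : Measurable τ) (hc : ∀ x ∉ s, ContinuousAt τ x)
    (hb : ∀ A ∈ 𝒜, ∀ i j, A i j ∈ Icc (-1 : ℝ) 1)
    (hs : ∀ A ∈ closure 𝒜, ∀ᵐ z ∂gaussPi n, A *ᵥ z ∉ s) {c : ℕ → ℝ} (hcm : Monotone c)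
    {β : ℝ≥0∞} (h : ∀ m, β < supRej τ 𝒜 (c m)) :
    ∃ A ∈ closure 𝒜, ∀ m, β ≤ rejProb τ A (c m) := by
  have h' : ∀ m, ∃ A ∈ 𝒜, β < rejProb τ A (c m) := fun m => by
    simpa only [supRej, lt_iSup_iff, exists_prop] using h m
  choose A hA hAβ using h'
  have hK : IsCompact {A : Matrix (Fin n) (Fin n) ℝ | ∀ i j, A i j ∈ Icc (-1 : ℝ) 1} := by
    have : IsCompact (Set.pi univ fun _ : Fin n => Set.pi univ fun _ : Fin n => Icc (-1 : ℝ) 1) :=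
      isCompact_univ_pi fun _ => isCompact_univ_pi fun _ => isCompact_Icc
    have hset : (Set.pi univ fun _ : Fin n => Set.pi univ fun _ : Fin n => Icc (-1 : ℝ) 1) =
        {A : Fin n → Fin n → ℝ | ∀ i j, A i j ∈ Icc (-1 : ℝ) 1} := by
      ext A
      simp only [mem_ofPred_eq, mem_univ_pi]
    rw [hset] at this
    exact this
  obtain ⟨A₀, -, φ, hφ, hlim⟩ := hK.tendsto_subseq fun m => hb _ (hA m)
  have hcl : A₀ ∈ closure 𝒜 :=
    mem_closure_of_tendsto hlim (Eventually.of_forall fun m => hA _)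
  refine ⟨A₀, hcl, fun m => le_rejProb_of_tendsto hτ hc hlim (hs _ hcl) ?_⟩
  filter_upwards [eventually_ge_atTop m] with j hj
  exact (hAβ (φ j)).le.trans (rejProb_anti _ (hcm (hj.trans (hφ.id_le j))))

theorem exists_supRej_le (hτ : Measurable τ) (hc : ∀ x ∉ s, ContinuousAt τ x)
    (hb : ∀ A ∈ 𝒜, ∀ i j, A i j ∈ Icc (-1 : ℝ) 1)
    (hs : ∀ A ∈ closure 𝒜, ∀ᵐ z ∂gaussPi n, A *ᵥ z ∉ s) {α : ℝ≥0∞} (hα : 0 < α) :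
    ∃ C, supRej τ 𝒜 C ≤ α := by
  by_contra! h
  obtain ⟨A, -, hA⟩ := exists_limit_le_rejProb hτ hc hb hs (c := fun m => (m : ℝ))
    Nat.mono_cast fun m => h m
  have hanti : Antitone fun m : ℕ => {z | (m : ℝ) ≤ τ (A *ᵥ z)} := fun a b hab z hz =>
    show (a : ℝ) ≤ τ (A *ᵥ z) from
      (Nat.cast_le.2 hab).trans (show (b : ℝ) ≤ τ (A *ᵥ z) from hz)
  have h1 : α ≤ gaussPi n (⋂ m : ℕ, {z | (m : ℝ) ≤ τ (A *ᵥ z)}) := by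
    rw [hanti.measure_iInter (fun m => (measurableSet_le measurable_const
      (measurable_comp_mulVec hτ A)).nullMeasurableSet) ⟨0, measure_ne_top _ _⟩]
    exact le_iInf hA
  have h2 : (⋂ m : ℕ, {z | (m : ℝ) ≤ τ (A *ᵥ z)}) = ∅ := by
    refine eq_empty_iff_forall_notMem.2 fun z hz => ?_
    obtain ⟨m, hm⟩ := exists_nat_gt (τ (A *ᵥ z))
    exact absurd (mem_iInter.1 hz m) (not_le.2 hm)
  rw [h2, measure_empty] at h1
  exact absurd h1 (not_le.2 hα)

theorem le_supRej_of_forall_lt (hτ : Measurable τ) (hc : ∀ x ∉ s, ContinuousAt τ x)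
    (hb : ∀ A ∈ 𝒜, ∀ i j, A i j ∈ Icc (-1 : ℝ) 1)
    (hs : ∀ A ∈ closure 𝒜, ∀ᵐ z ∂gaussPi n, A *ᵥ z ∉ s) {C : ℝ}
    (hC : ∀ A ∈ closure 𝒜, gaussPi n {z | τ (A *ᵥ z) = C} = 0) {α : ℝ≥0∞}
    (h : ∀ C' < C, α ≤ supRej τ 𝒜 C') : α ≤ supRej τ 𝒜 C := by
  refine le_of_forall_lt fun β hβ => ?_
  -- The strict gap below `α` lets matrices in `𝒜` attain `β'`, though the supremum need not be
  -- attained.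
  obtain ⟨β', hβ1, hβ2⟩ := exists_between hβ
  refine hβ1.trans_le ?_
  obtain ⟨c, hcm, hcC, hclim⟩ := exists_seq_strictMono_tendsto C
  obtain ⟨A, hA, hAβ⟩ := exists_limit_le_rejProb hτ hc hb hs hcm.monotone
    fun m => hβ2.trans_le (h _ (hcC m))
  have hanti : Antitone fun m : ℕ => {z | c m ≤ τ (A *ᵥ z)} := fun a b hab z hz =>
    le_trans (hcm.monotone hab) hz
  have h1 : β' ≤ gaussPi n (⋂ m : ℕ, {z | c m ≤ τ (A *ᵥ z)}) := by
    rw [hanti.measure_iInter (fun m => (measurableSet_le measurable_const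
      (measurable_comp_mulVec hτ A)).nullMeasurableSet) ⟨0, measure_ne_top _ _⟩]
    exact le_iInf hAβ
  -- The limit `A` need not lie in `𝒜`, so only its strict exceedance probability is bounded by the
  -- supremum; the missing atom is null by `hC`.
  have h2 : gaussPi n {z | C < τ (A *ᵥ z)} ≤ supRej τ 𝒜 C := by
    obtain ⟨B, hB, hBA⟩ := mem_closure_iff_seq_limit.1 hA
    exact measure_lt_le_of_tendsto hc hBA (hs A hA) fun m =>
      le_iSup₂ (f := fun A _ => rejProb τ A C) (B m) (hB m)
  refine h1.trans (le_trans (measure_mono_ae ?_) h2)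
  filter_upwards [measure_eq_zero_iff_ae_notMem.1 (hC A hA)] with z hz hz'
  exact lt_of_le_of_ne (le_of_tendsto' hclim fun m => mem_iInter.1 hz' m) (Ne.symm hz)

/-- Each fixed `A` is right-continuous at `C` when it has no atom there, and a bound on every `A`
bounds the supremum. No limits of `𝒜` enter. -/
theorem supRej_le_of_forall_gt {C : ℝ}
    (hC : ∀ A ∈ 𝒜, gaussPi n {z | τ (A *ᵥ z) = C} = 0) {α : ℝ≥0∞}
    (h : ∀ C' > C, supRej τ 𝒜 C' ≤ α) : supRej τ 𝒜 C ≤ α := by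
  refine iSup₂_le fun A hA => ?_
  obtain ⟨c, hcm, hcC, hclim⟩ := exists_seq_strictAnti_tendsto C
  have hmono : Monotone fun m : ℕ => {z | c m ≤ τ (A *ᵥ z)} := fun a b hab z hz =>
    le_trans (hcm.antitone hab) hz
  have h1 : gaussPi n (⋃ m, {z | c m ≤ τ (A *ᵥ z)}) ≤ α := by
    rw [hmono.measure_iUnion]
    exact iSup_le fun m => (le_iSup₂ (f := fun A _ => rejProb τ A (c m)) A hA).trans (h _ (hcC m))
  refine (measure_mono_ae ?_).trans h1
  filter_upwards [measure_eq_zero_iff_ae_notMem.1 (hC A hA)] with z hz hz'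
  obtain ⟨m, hm⟩ := (hclim.eventually (gt_mem_nhds (lt_of_le_of_ne hz' (Ne.symm hz)))).exists
  exact mem_iUnion.2 ⟨m, hm.le⟩

end rejection

/-! ### The normalized square roots of the covariance matrices -/

section frob

variable {n : ℕ}

theorem frob_nonneg (M : Matrix (Fin n) (Fin n) ℝ) : 0 ≤ frob M := Real.sqrt_nonneg _

theorem frob_smul {a : ℝ} (ha : 0 ≤ a) (M : Matrix (Fin n) (Fin n) ℝ) :
    frob (a • M) = a * frob M := by
  have : ∑ i, ∑ j, (a • M) i j ^ 2 = a ^ 2 * ∑ i, ∑ j, M i j ^ 2 := by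
    simp only [Matrix.smul_apply, smul_eq_mul, mul_pow, Finset.mul_sum]
  rw [frob, frob, this, Real.sqrt_mul (sq_nonneg a), Real.sqrt_sq ha]

theorem frob_eq_zero_iff (M : Matrix (Fin n) (Fin n) ℝ) : frob M = 0 ↔ M = 0 := by
  constructor
  · intro h
    rw [frob, Real.sqrt_eq_zero (by positivity)] at h
    rw [Finset.sum_eq_zero_iff_of_nonneg fun _ _ => by positivity] at h
    ext i j
    have := h i (Finset.mem_univ i)
    rw [Finset.sum_eq_zero_iff_of_nonneg fun _ _ => by positivity] at this
    simpa using this j (Finset.mem_univ j)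
  · rintro rfl
    simp [frob]

theorem abs_apply_le_frob (M : Matrix (Fin n) (Fin n) ℝ) (i j : Fin n) : |M i j| ≤ frob M := by
  rw [frob]
  refine Real.abs_le_sqrt ?_
  refine (Finset.single_le_sum (f := fun j => M i j ^ 2) (fun _ _ => by positivity)
    (Finset.mem_univ j)).trans ?_
  exact Finset.single_le_sum (f := fun i => ∑ j, M i j ^ 2) (fun _ _ => by positivity)
    (Finset.mem_univ i)

-- Cauchy–Schwarz for a Gram matrix gives `M i j ^ 2 ≤ M i i * M j j`; sum over `i` and `j`.
open scoped MatrixOrder in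
theorem frob_le_trace {M : Matrix (Fin n) (Fin n) ℝ} (hM : M.PosSemidef) : frob M ≤ M.trace := by
  refine Real.sqrt_le_iff.2 ⟨hM.trace_nonneg, ?_⟩
  obtain ⟨B, rfl⟩ := CStarAlgebra.nonneg_iff_eq_star_mul_self.1 hM.nonneg
  rw [sq, Matrix.trace, Finset.sum_mul_sum]
  refine Finset.sum_le_sum fun i _ => Finset.sum_le_sum fun j _ => ?_
  have := Finset.sum_mul_sq_le_sq_mul_sq Finset.univ (fun l => B l i) (fun l => B l j)
  simpa [Matrix.star_eq_conjTranspose, Matrix.mul_apply, sq] using this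

end frob

section roots

open scoped MatrixOrder

variable {n : ℕ} {L : Submodule ℝ (Rn n)} {𝒞 : Set (Matrix (Fin n) (Fin n) ℝ)}

/-- The matrices `Π √(σ² Σ)`, normalized such that their squares are the elements of
`normalizedProj L '' 𝒞`. -/
def normalizedRoots (L : Submodule ℝ (Rn n)) (𝒞 : Set (Matrix (Fin n) (Fin n) ℝ)) :
    Set (Matrix (Fin n) (Fin n) ℝ) :=
  {A | ∃ S ∈ 𝒞, ∃ σ2 : ℝ, 0 < σ2 ∧
    A = (Real.sqrt (frob (projPerp L * (σ2 • S) * projPerp L)))⁻¹ •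
      (projPerp L * CFC.sqrt (σ2 • S))}

theorem frob_proj_pos (hL : L ≠ ⊤) {S : Matrix (Fin n) (Fin n) ℝ} (hS : S.PosDef) :
    0 < frob (projPerp L * S * projPerp L) := by
  refine lt_of_le_of_ne (frob_nonneg _) fun h => ?_
  have h0 := (frob_eq_zero_iff _).1 h.symm
  obtain ⟨x, hx, hx0⟩ := (Submodule.ne_bot_iff Lᗮ).1
    (fun h => hL ((Submodule.orthogonal_eq_bot_iff).1 h))
  have hx1 : projPerp L *ᵥ x.ofLp = x.ofLp := (projPerp_mulVec_eq_self_iff L x.ofLp).2 hx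
  have hpos := hS.dotProduct_mulVec_pos (x := x.ofLp) fun h => hx0 (by ext i; simp [h])
  have : x.ofLp ⬝ᵥ ((projPerp L * S * projPerp L) *ᵥ x.ofLp) = x.ofLp ⬝ᵥ (S *ᵥ x.ofLp) := by
    rw [← Matrix.mulVec_mulVec, hx1, ← Matrix.mulVec_mulVec, Matrix.dotProduct_mulVec,
      ← Matrix.mulVec_transpose, projPerp_transpose, hx1]
  rw [h0, Matrix.zero_mulVec, dotProduct_zero] at this
  rw [star_trivial, ← this] at hpos
  exact lt_irrefl _ hpos

theorem sqrt_transpose (S : Matrix (Fin n) (Fin n) ℝ) : (CFC.sqrt S)ᵀ = CFC.sqrt S := by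
  rw [← Matrix.conjTranspose_eq_transpose_of_trivial]
  exact (Matrix.nonneg_iff_posSemidef.1 (CFC.sqrt_nonneg S)).1

theorem sqrt_mul_sqrt {S : Matrix (Fin n) (Fin n) ℝ} (hS : S.PosDef) :
    CFC.sqrt S * CFC.sqrt S = S :=
  CFC.sqrt_mul_sqrt_self S hS.posSemidef.nonneg

theorem normalizedRoots_mul_transpose (h𝒞 : ∀ S ∈ 𝒞, S.PosDef) {A : Matrix (Fin n) (Fin n) ℝ}
    (hA : A ∈ normalizedRoots L 𝒞) :
    ∃ S ∈ 𝒞, A * Aᵀ = normalizedProj L S := by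
  obtain ⟨S, hS, σ2, hσ, rfl⟩ := hA
  refine ⟨S, hS, ?_⟩
  have hP := (h𝒞 S hS).smul hσ
  have h1 : projPerp L * CFC.sqrt (σ2 • S) * (projPerp L * CFC.sqrt (σ2 • S))ᵀ =
      projPerp L * (σ2 • S) * projPerp L := by
    rw [Matrix.transpose_mul, sqrt_transpose, projPerp_transpose, Matrix.mul_assoc,
      ← Matrix.mul_assoc (CFC.sqrt _), sqrt_mul_sqrt hP, ← Matrix.mul_assoc]
  have h2 : projPerp L * (σ2 • S) * projPerp L = σ2 • (projPerp L * S * projPerp L) := by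
    rw [Matrix.mul_smul, Matrix.smul_mul]
  rw [Matrix.transpose_smul, Matrix.smul_mul, Matrix.mul_smul _ _ (_ᵀ), smul_smul, ← mul_inv,
    Real.mul_self_sqrt (frob_nonneg _), h1, h2, frob_smul hσ.le, normalizedProj, smul_smul]
  congr 1
  field_simp

theorem projPerp_mul_self : projPerp L * projPerp L = projPerp L := projPerp_mul_of_le le_rfl

theorem projPerp_mul_of_mem_normalizedRoots {A : Matrix (Fin n) (Fin n) ℝ}
    (hA : A ∈ normalizedRoots L 𝒞) : projPerp L * A = A := by
  obtain ⟨S, -, σ2, -, rfl⟩ := hA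
  rw [Matrix.mul_smul, ← Matrix.mul_assoc, projPerp_mul_self]

/-- Row norms are diagonal entries of `A A'`, which has Frobenius norm one. This supplies the
compactness. -/
theorem normalizedRoots_apply_mem (hL : L ≠ ⊤) (h𝒞 : ∀ S ∈ 𝒞, S.PosDef)
    {A : Matrix (Fin n) (Fin n) ℝ} (hA : A ∈ normalizedRoots L 𝒞) (i j : Fin n) :
    A i j ∈ Icc (-1 : ℝ) 1 := by
  obtain ⟨S, hS, h⟩ := normalizedRoots_mul_transpose h𝒞 hA
  have h1 : frob (A * Aᵀ) = 1 := by
    have := frob_proj_pos hL (h𝒞 S hS)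
    rw [h, normalizedProj, frob_smul (inv_nonneg.2 (frob_nonneg _)), inv_mul_cancel₀ this.ne']
  have h2 : A i j ^ 2 ≤ (A * Aᵀ) i i := by
    rw [Matrix.mul_apply]
    simp only [Matrix.transpose_apply, ← sq]
    exact Finset.single_le_sum (f := fun j => A i j ^ 2) (fun _ _ => by positivity)
      (Finset.mem_univ j)
  have h3 := (le_abs_self _).trans ((abs_apply_le_frob (A * Aᵀ) i i).trans h1.le)
  exact abs_le.1 ((sq_le_one_iff_abs_le_one _).1 (h2.trans h3))

theorem exists_mulVec_of_mem_normalizedRoots (hL : L ≠ ⊤) (h𝒞 : ∀ S ∈ 𝒞, S.PosDef)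
    {A : Matrix (Fin n) (Fin n) ℝ} (hA : A ∈ normalizedRoots L 𝒞) {x : Rn n} (hx : x ∈ Lᗮ) :
    ∃ z, A *ᵥ z = x.ofLp := by
  obtain ⟨S, hS, σ2, hσ, rfl⟩ := hA
  have hP := (h𝒞 S hS).smul hσ
  have hpos := frob_proj_pos hL hP
  have hu : IsUnit (CFC.sqrt (σ2 • S)) := by
    have := hP.isUnit
    rw [← sqrt_mul_sqrt hP] at this
    exact isUnit_of_mul_isUnit_left this
  have hx1 : projPerp L *ᵥ x.ofLp = x.ofLp := (projPerp_mulVec_eq_self_iff L x.ofLp).2 hx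
  refine ⟨Real.sqrt (frob (projPerp L * (σ2 • S) * projPerp L)) •
    ((CFC.sqrt (σ2 • S))⁻¹ *ᵥ x.ofLp), ?_⟩
  rw [Matrix.mulVec_smul, Matrix.smul_mulVec, smul_smul, mul_inv_cancel₀
    (Real.sqrt_pos.2 hpos).ne', one_smul, ← Matrix.mulVec_mulVec, Matrix.mulVec_mulVec _ _
    (CFC.sqrt (σ2 • S))⁻¹, Matrix.mul_nonsing_inv _ ((Matrix.isUnit_iff_isUnit_det _).1 hu),
    Matrix.one_mulVec, hx1]

theorem mul_transpose_mem_closure (h𝒞 : ∀ S ∈ 𝒞, S.PosDef) {A : Matrix (Fin n) (Fin n) ℝ}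
    (hA : A ∈ closure (normalizedRoots L 𝒞)) : A * Aᵀ ∈ closure (normalizedProj L '' 𝒞) := by
  refine map_mem_closure (f := fun A : Matrix (Fin n) (Fin n) ℝ => A * Aᵀ)
    (continuous_id.matrix_mul continuous_id.matrix_transpose) hA fun B hB => ?_
  obtain ⟨S, hS, h⟩ := normalizedRoots_mul_transpose h𝒞 hB
  exact ⟨S, hS, h.symm⟩

theorem projPerp_mul_of_mem_closure {A : Matrix (Fin n) (Fin n) ℝ}
    (hA : A ∈ closure (normalizedRoots L 𝒞)) : projPerp L * A = A := by
  have hc : IsClosed {A : Matrix (Fin n) (Fin n) ℝ | projPerp L * A = A} :=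
    isClosed_eq (continuous_const.matrix_mul continuous_id) continuous_id
  exact closure_minimal (fun B hB => projPerp_mul_of_mem_normalizedRoots hB) hc hA

/-- Under the condition on the matrices `E_{n,s}(γ)`, no limit of the normalized square roots
maps into `M`. -/
theorem projPerp_mul_ne_zero {M : Submodule ℝ (Rn n)} (hL : L ≠ ⊤) (hLM : L ≤ M)
    (h : ∀ γ ∈ Icc (0 : ℝ) Real.pi, ¬ colSpan (trigMatrix n (rho γ L) γ) ≤ M)
    {A : Matrix (Fin n) (Fin n) ℝ}
    (hA : A ∈ closure (normalizedRoots L (covModel n normalizedSpectralDensities))) :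
    projPerp M * (A * Aᵀ) ≠ 0 := by
  obtain ⟨C, hC⟩ := sum_quadForm_projPerp_le hLM h
  have h𝒞 : ∀ S ∈ covModel n normalizedSpectralDensities, S.PosDef := by
    rintro _ ⟨f, hf, rfl⟩
    exact spectralCov_posDef hf
  -- The inequality holds for every normalized root, because the Frobenius norm is at most the
  -- trace; being closed, it passes to limits and excludes a zero projection.
  have hc : IsClosed {A : Matrix (Fin n) (Fin n) ℝ |
      1 ≤ C * (projPerp M * (A * Aᵀ) * (projPerp M)ᵀ).trace} := by
    refine isClosed_le continuous_const (continuous_const.mul (Continuous.matrix_trace ?_))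
    exact ((continuous_const.matrix_mul (continuous_id.matrix_mul
      continuous_id.matrix_transpose)).matrix_mul continuous_const)
  have hsub : normalizedRoots L (covModel n normalizedSpectralDensities) ⊆
      {A : Matrix (Fin n) (Fin n) ℝ |
        1 ≤ C * (projPerp M * (A * Aᵀ) * (projPerp M)ᵀ).trace} := by
    intro B hB
    obtain ⟨S, hS, hBS⟩ := normalizedRoots_mul_transpose h𝒞 hB
    have hpos := frob_proj_pos hL (h𝒞 S hS)
    obtain ⟨f, hf, rfl⟩ := hS
    have h1 := hC f hf
    have h2 : frob (projPerp L * spectralCov n f * projPerp L) ≤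
        (projPerp L * spectralCov n f * (projPerp L)ᵀ).trace := by
      have := (spectralCov_posDef (n := n) hf).posSemidef.mul_mul_conjTranspose_same (projPerp L)
      rw [Matrix.conjTranspose_eq_transpose_of_trivial] at this
      simpa only [projPerp_transpose] using frob_le_trace this
    have hPQ : projPerp L * projPerp M = projPerp M := by
      have := congrArg Matrix.transpose (projPerp_mul_of_le hLM)
      rwa [Matrix.transpose_mul, projPerp_transpose, projPerp_transpose] at this
    have h3 : projPerp M * normalizedProj L (spectralCov n f) * (projPerp M)ᵀ =
        (frob (projPerp L * spectralCov n f * projPerp L))⁻¹ •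
          (projPerp M * spectralCov n f * (projPerp M)ᵀ) := by
      rw [normalizedProj, Matrix.mul_smul, Matrix.smul_mul, projPerp_transpose]
      congr 1
      rw [← Matrix.mul_assoc, ← Matrix.mul_assoc, projPerp_mul_of_le hLM, Matrix.mul_assoc, hPQ]
    rw [mem_ofPred_eq, hBS, h3, Matrix.trace_smul, smul_eq_mul, mul_left_comm, ← div_eq_inv_mul,
      one_le_div hpos]
    exact h2.trans h1
  intro h0
  have := closure_minimal hsub hc hA
  rw [mem_ofPred_eq, h0, Matrix.zero_mul, Matrix.trace_zero, mul_zero] at this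
  linarith

/-- Membership in `M` would annihilate a nonzero linear form in `z`. -/
theorem ae_mulVec_notMem {M : Submodule ℝ (Rn n)} {A : Matrix (Fin n) (Fin n) ℝ}
    (hA : projPerp M * A ≠ 0) :
    ∀ᵐ z ∂gaussPi n, (WithLp.toLp 2 (A *ᵥ z) : Rn n) ∉ M := by
  obtain ⟨i, j, hij⟩ : ∃ i j, (projPerp M * A) i j ≠ 0 := by
    by_contra! h
    exact hA (by ext i j; exact h i j)
  have hp : IsPoly fun z : Fin n → ℝ => ((projPerp M * A) *ᵥ z) i :=
    IsPoly.mulVec _ (fun l => IsPoly.coord l) i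
  have hnull := hp.gaussPi_null (x := Pi.single j 1) (by simpa using hij)
  filter_upwards [measure_eq_zero_iff_ae_notMem.1 hnull] with z hz hmem
  apply hz
  rw [← projPerp_mulVec_eq_zero_iff, Matrix.mulVec_mulVec] at hmem
  exact congrFun hmem i

/-- A limit of the normalized square roots whose square has the maximal rank has range `Lᗮ`. -/
theorem exists_mulVec_of_rank {A : Matrix (Fin n) (Fin n) ℝ} (hA : projPerp L * A = A)
    (hr : n - Module.finrank ℝ L ≤ (A * Aᵀ).rank) {x : Rn n} (hx : x ∈ Lᗮ) :
    ∃ z, A *ᵥ z = x.ofLp := by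
  set e := (WithLp.linearEquiv 2 ℝ (Fin n → ℝ)).symm
  set V : Submodule ℝ (Rn n) := (LinearMap.range A.mulVecLin).map e.toLinearMap with hV
  have hVL : V ≤ Lᗮ := by
    rintro _ ⟨_, ⟨z, rfl⟩, rfl⟩
    have := projPerp_mulVec_mem L (A *ᵥ z)
    rwa [Matrix.mulVec_mulVec, hA] at this
  have hfin : Module.finrank ℝ V = A.rank := LinearEquiv.finrank_map_eq e _
  have hLfin := Submodule.finrank_add_finrank_orthogonal L
  rw [finrank_euclideanSpace_fin] at hLfin
  rw [Matrix.rank_self_mul_transpose] at hr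
  have hEq : V = Lᗮ := Submodule.eq_of_le_of_finrank_le hVL (by omega)
  rw [← hEq] at hx
  obtain ⟨_, ⟨z, rfl⟩, rfl⟩ := hx
  exact ⟨z, rfl⟩

end roots

/-! ### The size of the weighted Eicker test -/

section size

open scoped MatrixOrder

variable {n k q : ℕ} {X : Matrix (Fin n) (Fin k) ℝ} {R : Matrix (Fin q) (Fin k) ℝ}
  {W : Matrix (Fin n) (Fin n) ℝ} {r : Fin q → ℝ} {𝒞 : Set (Matrix (Fin n) (Fin n) ℝ)}

variable (X R W) in
/-- The statistic for the restriction `R β = 0`, as a function on coordinate vectors. -/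
def centeredStat (x : Fin n → ℝ) : ℝ := eickerStat X R 0 W (WithLp.toLp 2 x)

theorem measurable_centeredStat : Measurable (centeredStat X R W) :=
  measurable_eickerStat.comp (PiLp.continuous_toLp 2 _).measurable

theorem finrank_colSpan {ι : Type} [Fintype ι] (A : Matrix (Fin n) ι ℝ) :
    Module.finrank ℝ (colSpan A) = A.rank := by
  rw [Matrix.rank_eq_finrank_span_cols,
    ← LinearEquiv.finrank_map_eq (WithLp.linearEquiv 2 ℝ (Fin n → ℝ)).symm, Submodule.map_span,
    ← range_comp]
  rfl

theorem colSpan_ne_top (hkn : k < n) (hX : X.rank = k) : colSpan X ≠ ⊤ := by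
  intro h
  have := finrank_colSpan X
  rw [h, finrank_top, finrank_euclideanSpace_fin, hX] at this
  omega

theorem nullDir_ne_top (hkn : k < n) (hX : X.rank = k) : nullDir X R ≠ ⊤ := fun h =>
  colSpan_ne_top hkn hX (top_le_iff.1 (h ▸ nullDir_le_colSpan))

theorem nullMeans_nonempty (hR : R.rank = q) : (nullMeans X R r).Nonempty := by
  obtain ⟨b, hb⟩ := mulVec_surjective_of_rank hR r
  exact ⟨_, b, rfl, hb⟩

theorem centeredStat_projPerp (hX : X.rank = k) (x : Fin n → ℝ) :
    centeredStat X R W (projPerp (nullDir X R) *ᵥ x) = centeredStat X R W x := by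
  have h : (WithLp.toLp 2 x : Rn n) = WithLp.toLp 2 (x - projPerp (nullDir X R) *ᵥ x) +
      WithLp.toLp 2 (projPerp (nullDir X R) *ᵥ x) := by
    rw [← WithLp.toLp_add, sub_add_cancel]
  rw [centeredStat, centeredStat, h,
    eickerStat_null_add hX (sub_projPerp_mulVec_mem (nullDir X R) x : _ ∈ nullDir X R)]

theorem centeredStat_smul {a : ℝ} (ha : a ≠ 0) (x : Fin n → ℝ) :
    centeredStat X R W (a • x) = centeredStat X R W x := by
  rw [centeredStat, centeredStat, WithLp.toLp_smul, eickerStat_smul a ha]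

theorem eickerStat_eq_centered (hX : X.rank = k) {μ : Rn n} (hμ : μ ∈ nullMeans X R r) (y : Rn n) :
    eickerStat X R r W y = eickerStat X R 0 W (-μ + y) := by
  have h := eickerStat_null_add (W := W) hX hμ (-μ + y)
  rwa [add_neg_cancel_left] at h

theorem multivariateGaussian_setOf_le {g : Rn n → ℝ} (hg : Measurable g) (μ : Rn n)
    (S : Matrix (Fin n) (Fin n) ℝ) (C : ℝ) :
    multivariateGaussian μ S {y | C ≤ g (-μ + y)} =
      rejProb (fun x => g (WithLp.toLp 2 x)) (CFC.sqrt S) C := by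
  have hm : MeasurableSet {y | C ≤ g (-μ + y)} :=
    measurableSet_le measurable_const (hg.comp (measurable_const_add _))
  have hf : Measurable fun x : Rn n => μ + Matrix.toEuclideanCLM (𝕜 := ℝ) (CFC.sqrt S) x := by
    fun_prop
  rw [multivariateGaussian, ← map_pi_eq_stdGaussian, Measure.map_apply hf hm,
    Measure.map_apply (PiLp.continuous_toLp 2 _).measurable (hf hm), rejProb]
  congr 1
  ext z
  simp only [mem_preimage, mem_ofPred_eq, neg_add_cancel_left, Matrix.toEuclideanCLM_toLp]

theorem multivariateGaussian_le_eickerStat (hX : X.rank = k) {μ : Rn n}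
    (hμ : μ ∈ nullMeans X R r) (S : Matrix (Fin n) (Fin n) ℝ) (C : ℝ) :
    multivariateGaussian μ S {y | C ≤ eickerStat X R r W y} =
      rejProb (centeredStat X R W) (CFC.sqrt S) C := by
  simp only [eickerStat_eq_centered hX hμ]
  exact multivariateGaussian_setOf_le measurable_eickerStat μ S C

theorem rejProb_normalizedRoot (hX : X.rank = k) {a : ℝ} (ha : a ≠ 0)
    (B : Matrix (Fin n) (Fin n) ℝ) (C : ℝ) :
    rejProb (centeredStat X R W) (a • (projPerp (nullDir X R) * B)) C =
      rejProb (centeredStat X R W) B C := by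
  have h : ∀ z, centeredStat X R W ((a • (projPerp (nullDir X R) * B)) *ᵥ z) =
      centeredStat X R W (B *ᵥ z) := fun z => by
    rw [Matrix.smul_mulVec, centeredStat_smul ha, ← Matrix.mulVec_mulVec, centeredStat_projPerp hX]
  simp only [rejProb, h]

/-- Invariance removes the mean and the normalization. As `normalizedRoots` retains `σ²`, the two
suprema match term by term. -/
theorem size_eq_supRej (hkn : k < n) (hX : X.rank = k) (hR : R.rank = q)
    (h𝒞 : ∀ S ∈ 𝒞, S.PosDef) (C : ℝ) :
    size (nullMeans X R r) 𝒞 (eickerStat X R r W) C =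
      supRej (centeredStat X R W) (normalizedRoots (nullDir X R) 𝒞) C := by
  have hL := nullDir_ne_top (R := R) hkn hX
  have ha : ∀ S ∈ 𝒞, ∀ σ2 : ℝ, 0 < σ2 → (Real.sqrt (frob (projPerp (nullDir X R) *
      (σ2 • S) * projPerp (nullDir X R))))⁻¹ ≠ 0 := fun S hS σ2 hσ =>
    inv_ne_zero (Real.sqrt_pos.2 (frob_proj_pos hL ((h𝒞 S hS).smul hσ))).ne'
  apply le_antisymm
  · refine iSup₂_le fun μ hμ => iSup₂_le fun σ2 hσ => iSup₂_le fun S hS => ?_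
    rw [multivariateGaussian_le_eickerStat hX hμ,
      ← rejProb_normalizedRoot hX (ha S hS σ2 hσ)]
    exact le_iSup₂ (f := fun A _ => rejProb (centeredStat X R W) A C) _ ⟨S, hS, σ2, hσ, rfl⟩
  · obtain ⟨μ, hμ⟩ := nullMeans_nonempty (X := X) (r := r) hR
    refine iSup₂_le ?_
    rintro _ ⟨S, hS, σ2, hσ, rfl⟩
    rw [rejProb_normalizedRoot hX (ha S hS σ2 hσ),
      ← multivariateGaussian_le_eickerStat (r := r) hX hμ]
    exact le_iSup₂_of_le μ hμ (le_iSup₂_of_le σ2 hσ (le_iSup₂_of_le S hS le_rfl))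

theorem one_le_supRej_of_nonpos (hq : 1 ≤ q) (hX : X.rank = k) (hR : R.rank = q)
    (hW : IsWeightMatrix W) (hne : 𝒞.Nonempty) {C : ℝ} (hC : C ≤ 0) :
    1 ≤ supRej (centeredStat X R W) (normalizedRoots (nullDir X R) 𝒞) C := by
  obtain ⟨S, hS⟩ := hne
  refine le_iSup₂_of_le _ ⟨S, hS, 1, one_pos, rfl⟩ ?_
  have h : ∀ A : Matrix (Fin n) (Fin n) ℝ, {z | C ≤ centeredStat X R W (A *ᵥ z)} = univ :=
    fun A => eq_univ_of_forall fun z => hC.trans (eickerStat_nonneg hq hX hR hW _)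
  rw [rejProb, h, measure_univ]

/-- The set of `x` with `centeredStat x = C` is null under a Gaussian law unless it contains all
nonsingular points of the support. -/
theorem centeredStat_eq_of_measure_ne_zero (hq : 1 ≤ q) (hX : X.rank = k) (hR : R.rank = q)
    (hW : IsWeightMatrix W) {A : Matrix (Fin n) (Fin n) ℝ} (hA : projPerp (colSpan X) * A ≠ 0)
    {C : ℝ} (h : gaussPi n {z | centeredStat X R W (A *ᵥ z) = C} ≠ 0) (z : Fin n → ℝ)
    (hz : (WithLp.toLp 2 (A *ᵥ z) : Rn n) ∉ colSpan X) : centeredStat X R W (A *ᵥ z) = C := by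
  have hden : ∀ x : Fin n → ℝ, (WithLp.toLp 2 x : Rn n) ∉ colSpan X → statDen X R W x ≠ 0 :=
    fun x hx => (det_omegaHat_ne_zero_iff hq hX hR hW _).2 hx
  have hlin : ∀ i, IsPoly fun z : Fin n → ℝ => (A *ᵥ z) i :=
    IsPoly.mulVec A fun j => IsPoly.coord j
  -- Clearing the denominator turns the level set into the zero set of a polynomial in `z`, which is
  -- null as soon as the polynomial is nonzero at one point.
  have hp : IsPoly fun z : Fin n → ℝ => statNum X R W (A *ᵥ z) - C * statDen X R W (A *ᵥ z) :=
    (isPoly_statNum.comp hlin).sub ((IsPoly.const C).mul (isPoly_statDen.comp hlin))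
  by_contra hne
  have h0 : statNum X R W (A *ᵥ z) - C * statDen X R W (A *ᵥ z) ≠ 0 := by
    intro h0
    apply hne
    rw [centeredStat, eickerStat_eq_div, div_eq_iff (hden _ hz)]
    linarith
  apply h
  rw [measure_eq_zero_iff_ae_notMem]
  filter_upwards [measure_eq_zero_iff_ae_notMem.1 (hp.gaussPi_null h0), ae_mulVec_notMem hA]
    with y hy1 hy2 hy3
  apply hy1
  rw [centeredStat, eickerStat_eq_div, div_eq_iff (hden _ hy2)] at hy3
  linarith

/-- If the range of `A` contains `Lᗮ`, an atom would, by invariance along `L`, make the statistic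
constant off `span(X)`, contrary to `eickerStat_not_const`. -/
theorem measure_centeredStat_eq_zero (hq : 1 ≤ q) (hkn : k < n) (hX : X.rank = k)
    (hR : R.rank = q) (hW : IsWeightMatrix W) {A : Matrix (Fin n) (Fin n) ℝ}
    (hA : projPerp (colSpan X) * A ≠ 0)
    (hr : ∀ x ∈ (nullDir X R)ᗮ, ∃ z, A *ᵥ z = x.ofLp) (C : ℝ) :
    gaussPi n {z | centeredStat X R W (A *ᵥ z) = C} = 0 := by
  by_contra h
  obtain ⟨y, hy, hyC⟩ := eickerStat_not_const hq hkn hX hR hW C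
  apply hyC
  obtain ⟨z, hz⟩ := hr _ (projPerp_mulVec_mem (nullDir X R) y.ofLp)
  have hmem : (WithLp.toLp 2 (A *ᵥ z) : Rn n) ∉ colSpan X := by
    rw [hz]
    intro hcon
    have h1 := nullDir_le_colSpan (sub_projPerp_mulVec_mem (nullDir X R) y.ofLp)
    have h2 := (colSpan X).add_mem h1 hcon
    rw [← WithLp.toLp_add, sub_add_cancel] at h2
    exact hy h2
  have h3 := centeredStat_eq_of_measure_ne_zero hq hX hR hW hA h z hmem
  rw [hz] at h3
  exact (centeredStat_projPerp hX y.ofLp).symm.trans h3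

/-- An atom at `C` forces the value `C` on the range of `A` off `span(X)`, hence almost everywhere
on the limit space, so `C` is one of the constants entering `C*`. -/
theorem le_cStar_of_measure_ne_zero (hq : 1 ≤ q) (hX : X.rank = k) (hR : R.rank = q)
    (hW : IsWeightMatrix W) {A : Matrix (Fin n) (Fin n) ℝ}
    (hA : projPerp (colSpan X) * (A * Aᵀ) ≠ 0)
    (hcl : A * Aᵀ ∈ closure (normalizedProj (nullDir X R) '' 𝒞))
    (hr : (A * Aᵀ).rank < n - Module.finrank ℝ (nullDir X R)) {C : ℝ}
    (h : gaussPi n {z | centeredStat X R W (A *ᵥ z) = C} ≠ 0) :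
    (C : EReal) ≤ cStar (nullMeans X R r) (nullDir X R) 𝒞 (eickerStat X R r W) := by
  have hA' : projPerp (colSpan X) * A ≠ 0 := fun h0 => hA (by
    rw [← Matrix.mul_assoc, h0, Matrix.zero_mul])
  obtain ⟨μ, hμ⟩ := nullMeans_nonempty (X := X) (r := r) hR
  refine le_sSup ⟨C, rfl, colSpan (A * Aᵀ), ⟨_, hcl, hr, rfl⟩, μ, hμ, ?_⟩
  have hT : Measurable fun y => eickerStat X R r W y := by
    simp only [eickerStat_eq_centered hX hμ]
    exact measurable_eickerStat.comp (measurable_const_add _)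
  rw [affineLebesgue, ae_map_iff (by fun_prop) (measurableSet_eq_fun hT measurable_const)]
  -- `span(X)` meets the limit space in a proper subspace, which is Lebesgue null.
  have hne : (colSpan X).comap (colSpan (A * Aᵀ)).subtype ≠ ⊤ := by
    intro htop
    apply hA
    refine Matrix.ext_of_mulVec_single fun j => ?_
    rw [← Matrix.mulVec_mulVec, Matrix.zero_mulVec, projPerp_mulVec_eq_zero_iff]
    exact Submodule.comap_subtype_eq_top.1 htop (mem_colSpan_iff.2 ⟨_, rfl⟩)
  have hnull := Measure.addHaar_submodule
    ((stdOrthonormalBasis ℝ (colSpan (A * Aᵀ))).toBasis.addHaar) _ hne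
  filter_upwards [measure_eq_zero_iff_ae_notMem.1 hnull] with v hv
  obtain ⟨b, hb⟩ := mem_colSpan_iff.1 v.2
  -- A point of the column space of `A A'` is `A` applied to `A' b`, so the statement about the
  -- range of `A` applies.
  rw [← Matrix.mulVec_mulVec] at hb
  have hv' : (v : Rn n) ∉ colSpan X := hv
  rw [eickerStat_null_add hX hμ, hb]
  exact centeredStat_eq_of_measure_ne_zero hq hX hR hW hA' h _ (by rwa [← hb])

theorem colSpan_fromCols {m : ℕ} (E : Matrix (Fin n) (Fin m) ℝ) :
    colSpan (Matrix.fromCols X E) = colSpan X ⊔ colSpan E := by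
  rw [colSpan, colSpan, colSpan, ← Submodule.span_union, Sum.range_eq]
  rfl

theorem not_colSpan_le_iff_rank {m : ℕ} (hX : X.rank = k) (E : Matrix (Fin n) (Fin m) ℝ) :
    ¬ colSpan E ≤ colSpan X ↔ k < (Matrix.fromCols X E).rank := by
  rw [← finrank_colSpan, colSpan_fromCols]
  have hk : Module.finrank ℝ (colSpan X) = k := by rw [finrank_colSpan, hX]
  constructor
  · intro h
    exact hk.symm.trans_lt (Submodule.finrank_lt_finrank_of_lt (left_lt_sup.2 h))
  · intro h hle
    rw [sup_eq_left.2 hle, hk] at h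
    exact lt_irrefl _ h

end size

end Eicker

end

/-! ### The main theorem. -/

open Eicker
theorem mainTheorem2 (n k q : ℕ) (hk : 1 ≤ k) (hkn : k < n) (hq : 1 ≤ q)
    (X : Matrix (Fin n) (Fin k) ℝ) (hX : X.rank = k)
    (R : Matrix (Fin q) (Fin k) ℝ) (hR : R.rank = q) (r : Fin q → ℝ)
    (W : Matrix (Fin n) (Fin n) ℝ) (hW : IsWeightMatrix W) :
    ((∀ γ ∈ Icc (0 : ℝ) Real.pi,
        ¬ colSpan (trigMatrix n (rho γ (nullDir X R)) γ) ≤ colSpan X) →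
      (∀ α ∈ Ioo (0 : ℝ) 1, ∃ C : ℝ,
        size (nullMeans X R r) (covModel n normalizedSpectralDensities)
          (eickerStat X R r W) C ≤ ENNReal.ofReal α) ∧
      (∀ α ∈ Ioo (0 : ℝ) 1,
        ENNReal.ofReal α ≤ alphaStar (nullMeans X R r) (nullDir X R)
          (covModel n normalizedSpectralDensities) (eickerStat X R r W) →
        ∃ C : ℝ, size (nullMeans X R r) (covModel n normalizedSpectralDensities)
          (eickerStat X R r W) C = ENNReal.ofReal α)) ∧
    ((∀ γ ∈ Icc (0 : ℝ) Real.pi,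
        ¬ colSpan (trigMatrix n (rho γ (nullDir X R)) γ) ≤ colSpan X) ↔
      (∀ γ ∈ Icc (0 : ℝ) Real.pi,
        k < (Matrix.fromCols X (trigMatrix n (rho γ (nullDir X R)) γ)).rank)) := by
  refine ⟨fun h => ?_, forall₂_congr fun γ _ => not_colSpan_le_iff_rank hX _⟩
  have h𝒞 : ∀ S ∈ covModel n normalizedSpectralDensities, S.PosDef := by
    rintro _ ⟨f, hf, rfl⟩
    exact spectralCov_posDef hf
  have hL := nullDir_ne_top (R := R) hkn hX
  have hQ : ∀ A ∈ closure (normalizedRoots (nullDir X R)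
      (covModel n normalizedSpectralDensities)), projPerp (colSpan X) * A ≠ 0 := by
    intro A hA h0
    apply projPerp_mul_ne_zero hL nullDir_le_colSpan h hA
    rw [← Matrix.mul_assoc, h0, Matrix.zero_mul]
  set 𝒜 := normalizedRoots (nullDir X R) (covModel n normalizedSpectralDensities) with h𝒜
  have hc : ∀ x ∉ {x : Fin n → ℝ | (WithLp.toLp 2 x : Rn n) ∈ colSpan X},
      ContinuousAt (centeredStat X R W) x := fun x hx =>
    continuousAt_eickerStat ((det_omegaHat_ne_zero_iff hq hX hR hW _).2 hx)
  have hb : ∀ A ∈ 𝒜, ∀ i j, A i j ∈ Icc (-1 : ℝ) 1 := fun A hA =>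
    normalizedRoots_apply_mem hL h𝒞 hA
  have hs : ∀ A ∈ closure 𝒜, ∀ᵐ z ∂gaussPi n,
      A *ᵥ z ∉ {x : Fin n → ℝ | (WithLp.toLp 2 x : Rn n) ∈ colSpan X} := fun A hA =>
    ae_mulVec_notMem (hQ A hA)
  have hsize : ∀ C, size (nullMeans X R r) (covModel n normalizedSpectralDensities)
      (eickerStat X R r W) C = supRej (centeredStat X R W) 𝒜 C :=
    size_eq_supRej hkn hX hR h𝒞
  have hexists : ∀ α ∈ Ioo (0 : ℝ) 1,
      ∃ C, supRej (centeredStat X R W) 𝒜 C ≤ ENNReal.ofReal α := fun α hα =>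
    exists_supRej_le measurable_centeredStat hc hb hs (ENNReal.ofReal_pos.2 hα.1)
  simp only [hsize]
  refine ⟨hexists, fun α hα hstar => ?_⟩
  set B : Set ℝ := {C | supRej (centeredStat X R W) 𝒜 C ≤ ENNReal.ofReal α} with hB
  have hBne : B.Nonempty := hexists α hα
  -- The statistic is nonnegative, so the size is one for negative `C`, whereas `α < 1`.
  have hBbdd : BddBelow B := ⟨0, fun C hC => by
    by_contra! hneg
    have h1 := (one_le_supRej_of_nonpos hq hX hR hW (covModel_nonempty n) hneg.le).trans hC
    exact absurd (ENNReal.one_le_ofReal.1 h1) (not_le.2 hα.2)⟩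
  -- The size is nonincreasing in `C`: it is at most `α` to the right of `sInf B` and above `α` to
  -- the left. Both bounds have to be carried to the point itself.
  refine ⟨sInf B, le_antisymm ?_ ?_⟩
  · refine supRej_le_of_forall_gt (fun A hA => measure_centeredStat_eq_zero hq hkn hX hR hW
      (hQ A (subset_closure hA))
      (fun x hx => exists_mulVec_of_mem_normalizedRoots hL h𝒞 hA hx) _) fun C' hC' => ?_
    obtain ⟨b, hb, hbC⟩ := exists_lt_of_csInf_lt hBne hC'
    exact (supRej_anti hbC.le).trans hb
  · rcases le_or_gt ((sInf B : ℝ) : EReal) (cStar (nullMeans X R r) (nullDir X R)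
      (covModel n normalizedSpectralDensities) (eickerStat X R r W)) with hle | hlt
    -- Every `C > C*` exceeds `sInf B`, so monotonicity puts the size at `sInf B` above `α*`.
    · refine hstar.trans (iSup₂_le fun C hC => ?_)
      rw [hsize]
      exact supRej_anti (EReal.coe_lt_coe_iff.1 (hle.trans_lt hC)).le
    · refine le_supRej_of_forall_lt measurable_centeredStat hc hb hs (fun A hA => ?_)
        fun C' hC' => (not_le.1 fun hmem => notMem_of_lt_csInf hC' hBbdd hmem).le
      by_contra h0
      -- An atom of a limit of deficient rank would give `sInf B ≤ C*`; a limit of full rank maps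
      -- onto `Lᗮ` and has no atoms.
      by_cases hr : (A * Aᵀ).rank < n - Module.finrank ℝ (nullDir X R)
      · exact absurd (le_cStar_of_measure_ne_zero (r := r) hq hX hR hW
          (projPerp_mul_ne_zero hL nullDir_le_colSpan h hA)
          (mul_transpose_mem_closure h𝒞 hA) hr h0) (not_le.2 hlt)
      · exact h0 (measure_centeredStat_eq_zero hq hkn hX hR hW (hQ A hA)
          (fun x hx => exists_mulVec_of_rank (projPerp_mul_of_mem_closure hA)
            (not_lt.1 hr) hx) _)
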